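/- Let $M\subset\mathbb R^3$ be open with almost everywhere smooth boundary (the boundary points near which $M$ is not of the form $\{g<0\}$ with $g$ smooth and $\nabla g\neq0$ form a set of zero two-dimensional Hausdorff measure), and let $I\subset\mathbb R$ be an interval. Let $e,P,T$ be functions of $(\rho,\eta)\in(0,\infty)\times\mathbb R$, with $e$ smooth, such that $T\,d\eta=de-P\rho^{-2}d\rho$. Let the velocity $u$, the density $\rho>0$, the specific entropy $\eta$ and the magnetic field $B$ be smooth on a neighbourhood of $I\times\overline M$ and satisfy, for $t\in I$ and $x\in M$, the compressible adiabatic MHD superfluid/superconductive system $$\partial_t u=-\langle u,\nabla\rangle u-\rho^{-1}\nabla P(\rho,\eta)+\rho^{-1}(\nabla\times B)\times B,\quad \partial_t\rho=-\langle\nabla,\rho u\rangle,\quad \partial_t\eta=-\langle u,\nabla\eta\rangle,\quad \partial_t B=\nabla\times(u\times B),$$ with $\langle n,u\rangle=0$ at the smooth points of $\partial M$, where $n$ is the unit outward normal. Let $A_0$ be a smooth (up to $\partial M$) magnetic potential, $B=\nabla\times A_0$, with $\partial_tA_0=-E$, where $E=-u\times B$, and let $\psi$ be any smooth (up to $\partial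 M$) gauge function with $\partial_t\psi+L_u\psi+\langle u,A_0\rangle=0$. Put $A=A_0+\nabla\psi$, $v=\rho^{-1}B$ and, for $n\ge0$, $$\tilde\gamma_n=\rho\,L_v^n\big(\rho^{-1}\langle B,A\rangle\big),\qquad \tilde H_n(t)=\int_M\tilde\gamma_n(t,x)\,d^3x,$$ where $L_vf=\langle v,\nabla f\rangle$. If $M$ is unbounded, assume for the given $n$ that $\tilde\gamma_n(t,\cdot)$ is integrable over $M$ for all $t\in I$ and that the flux $\tilde\gamma_nu$ is integrable over $[s,t]\times M$ for all $s\le t$ in $I$. Then, for every $n\ge0$, $\tilde\gamma_n(t,\cdot)$ is integrable over $M$ for every $t\in I$ and $\tilde H_n$ is conserved: $\tilde H_n(s)=\tilde H_n(t)$ for all $s,t\in I$. Moreover, $\tilde H_0(t)=\int_M\langle A,\nabla\times A\rangle\,d^3x$ is the classical magnetic helicity. -/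

import Mathlib

open MeasureTheory Set
open scoped ContDiff

noncomputable section

namespace MHD

/-- The standard three-dimensional Euclidean vector space. -/
abbrev E3 : Type := EuclideanSpace ℝ (Fin 3)

/-! ### Vector calculus -/

/-- The vector product on Euclidean three-space. -/
def cross (a b : E3) : E3 := WithLp.toLp 2 (crossProduct a.ofLp b.ofLp)

/-- `partialD i F j x` is `∂F_j/∂x_i` at the point `x`. -/
def partialD (i : Fin 3) (F : E3 → E3) (j : Fin 3) (x : E3) : ℝ :=
  fderiv ℝ F x (EuclideanSpace.single i 1) j

/-- The divergence `⟨∇, F⟩`. -/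
def divergence (F : E3 → E3) (x : E3) : ℝ := ∑ i, partialD i F i x

/-- The curl `∇ × F`. -/
def curl (F : E3 → E3) (x : E3) : E3 :=
  !₂[partialD 1 F 2 x - partialD 2 F 1 x,
     partialD 2 F 0 x - partialD 0 F 2 x,
     partialD 0 F 1 x - partialD 1 F 0 x]

/-- The directional derivative `⟨w, ∇⟩ F` of a vector field `F` along a vector field `w`. -/
def advect (w F : E3 → E3) (x : E3) : E3 := fderiv ℝ F x (w x)

/-- The Lie derivative `L_w f = ⟨w, ∇ f⟩` of a function `f` along a vector field `w`. -/
def lieD (w : E3 → E3) (f : E3 → ℝ) (x : E3) : ℝ := fderiv ℝ f x (w x)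

/-! ### Smooth boundary points and normals -/

/-- `g` is a smooth local defining function of the open set `M` near the boundary point `x`:
near `x` one has `M = {g < 0}`, and `∇ g (x) ≠ 0`. -/
def IsLocalDefiningFunction (M : Set E3) (x : E3) (g : E3 → ℝ) : Prop :=
  ∃ U : Set E3, IsOpen U ∧ x ∈ U ∧ ContDiffOn ℝ ∞ g U ∧ gradient g x ≠ 0 ∧
    M ∩ U = {y ∈ U | g y < 0}

/-- `n` is the outward unit normal of `M` at the (smooth) boundary point `x`. -/
def IsOuterUnitNormal (M : Set E3) (x n : E3) : Prop :=
  x ∈ frontier M ∧ ∃ g : E3 → ℝ, IsLocalDefiningFunction M x g ∧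
    n = ‖gradient g x‖⁻¹ • gradient g x

/-- The boundary of `M` is almost everywhere smooth: the boundary points near which `M` has no
smooth defining function form a set of zero two-dimensional Hausdorff measure. -/
def HasAESmoothBoundary (M : Set E3) : Prop :=
  Measure.hausdorffMeasure 2
    {x : E3 | x ∈ frontier M ∧ ¬ ∃ g : E3 → ℝ, IsLocalDefiningFunction M x g} = 0

/-! ### The equations -/

/-- The time-dependent field `F` is smooth for times in `I`, up to the boundary of `M`:
it is smooth on some open neighbourhood of `I × closure M`. -/
def SmoothUpToBoundary {X : Type*} [NormedAddCommGroup X] [NormedSpace ℝ X]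
    (I : Set ℝ) (M : Set E3) (F : ℝ → E3 → X) : Prop :=
  ∃ Ω : Set (ℝ × E3), IsOpen Ω ∧ I ×ˢ closure M ⊆ Ω ∧
    ContDiffOn ℝ ∞ (fun p : ℝ × E3 => F p.1 p.2) Ω

/-- The specific energy, pressure and temperature as functions of density and specific entropy,
related by the first law of thermodynamics. -/
structure Thermodynamics where
  /-- specific internal energy -/
  e : ℝ → ℝ → ℝ
  /-- pressure -/
  P : ℝ → ℝ → ℝ
  /-- absolute temperature -/
  T : ℝ → ℝ → ℝ
  smooth_e : ContDiffOn ℝ ∞ (fun p : ℝ × ℝ => e p.1 p.2) (Ioi 0 ×ˢ univ)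
  /-- `T dη = de - P ρ⁻² dρ` -/
  first_law : ∀ r s : ℝ, 0 < r →
    T r s • ContinuousLinearMap.snd ℝ ℝ ℝ =
      fderiv ℝ (fun p : ℝ × ℝ => e p.1 p.2) (r, s)
        - (P r s * (r ^ 2)⁻¹) • ContinuousLinearMap.fst ℝ ℝ ℝ

/-- Smooth solutions, for times in `I`, of the compressible adiabatic MHD system in `M`, with
velocity `u` tangent to the boundary, density `ρ`, specific entropy `η`, magnetic field `B`. -/
structure IsSolution (th : Thermodynamics) (I : Set ℝ) (M : Set E3)
    (u : ℝ → E3 → E3) (ρ η : ℝ → E3 → ℝ) (B : ℝ → E3 → E3) : Prop where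
  smooth_u : SmoothUpToBoundary I M u
  smooth_ρ : SmoothUpToBoundary I M ρ
  smooth_η : SmoothUpToBoundary I M η
  smooth_B : SmoothUpToBoundary I M B
  ρ_pos : ∀ t ∈ I, ∀ x ∈ closure M, 0 < ρ t x
  momentum : ∀ t ∈ I, ∀ x ∈ M,
    deriv (fun s => u s x) t =
      - advect (u t) (u t) x
        - (ρ t x)⁻¹ • gradient (fun y => th.P (ρ t y) (η t y)) x
        + (ρ t x)⁻¹ • cross (curl (B t) x) (B t x)
  mass : ∀ t ∈ I, ∀ x ∈ M,
    deriv (fun s => ρ s x) t = - divergence (fun y => ρ t y • u t y) x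
  entropy : ∀ t ∈ I, ∀ x ∈ M,
    deriv (fun s => η s x) t = - inner ℝ (u t x) (gradient (η t) x)
  induction : ∀ t ∈ I, ∀ x ∈ M,
    deriv (fun s => B s x) t = curl (fun y => cross (u t y) (B t y)) x
  tangent_u : ∀ t ∈ I, ∀ x n : E3, IsOuterUnitNormal M x n → inner ℝ n (u t x) = 0

/-- The electric field determined by the superconductivity condition `E + u × B = 0`. -/
def electricField (u B : ℝ → E3 → E3) (t : ℝ) (x : E3) : E3 := - cross (u t x) (B t x)

/-- `A` is a magnetic potential: `B = ∇ × A` and `E = -∂A/∂t`. -/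
structure IsMagneticPotential (I : Set ℝ) (M : Set E3) (u B A : ℝ → E3 → E3) : Prop where
  smooth : SmoothUpToBoundary I M A
  curl_eq : ∀ t ∈ I, ∀ x ∈ M, B t x = curl (A t) x
  electric : ∀ t ∈ I, ∀ x ∈ M, electricField u B t x = - deriv (fun s => A s x) t

/-- `ψ` is an admissible gauge function for `A`: `∂ψ/∂t + L_u ψ + ⟨u, A⟩ = 0`. -/
structure IsGaugeFunction (I : Set ℝ) (M : Set E3) (u A : ℝ → E3 → E3)
    (ψ : ℝ → E3 → ℝ) : Prop where
  smooth : SmoothUpToBoundary I M ψ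
  transport : ∀ t ∈ I, ∀ x ∈ M,
    deriv (fun s => ψ s x) t + lieD (u t) (ψ t) x + inner ℝ (u t x) (A t x) = 0

/-- The gauge-transformed potential `A + ∇ψ`. -/
def gaugeTransform (A : ℝ → E3 → E3) (ψ : ℝ → E3 → ℝ) (t : ℝ) (x : E3) : E3 :=
  A t x + gradient (ψ t) x

/-! ### The functionals -/

/-- The density `ρ L_v ^ n (ρ⁻¹ ⟨B, A⟩)` with `v = ρ⁻¹ B`, at a fixed time. -/
def helicityDensity (ρ : E3 → ℝ) (B A : E3 → E3) (n : ℕ) (x : E3) : ℝ :=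
  ρ x * (lieD (fun y => (ρ y)⁻¹ • B y))^[n] (fun y => (ρ y)⁻¹ * inner ℝ (B y) (A y)) x

/-- The functional `∫_M ρ L_v ^ n (ρ⁻¹ ⟨B, A⟩) d³x`, at a fixed time. -/
def helicity (M : Set E3) (ρ : E3 → ℝ) (B A : E3 → E3) (n : ℕ) : ℝ :=
  ∫ x in M, helicityDensity ρ B A n x

/-- The `n`-th density is integrable over `M` at all times, and its flux along `u` is integrable
over `[s, t] × M` for all times `s, t` (a condition at infinity: for fields that are smooth up to
the boundary of a bounded `M` it always holds). -/
def IntegrableDensityAndFlux (I : Set ℝ) (M : Set E3) (u : ℝ → E3 → E3) (ρ : ℝ → E3 → ℝ)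
    (B A : ℝ → E3 → E3) (n : ℕ) : Prop :=
  (∀ t ∈ I, IntegrableOn (helicityDensity (ρ t) (B t) (A t) n) M) ∧
  ∀ s ∈ I, ∀ t ∈ I, IntegrableOn
    (fun p : ℝ × E3 => helicityDensity (ρ p.1) (B p.1) (A p.1) n p.2 • u p.1 p.2)
    (Icc s t ×ˢ M)

end MHD

end

namespace MHD

open Filter Topology Metric

/-! ### Divergence calculus -/

lemma eq_sum_smul_single (w : E3) :
    w = ∑ i, w i • (EuclideanSpace.single i 1 : E3) := by
  ext j
  simp [Finset.sum_apply, Pi.single_apply]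

lemma fderiv_apply_eq_sum {X : Type*} [NormedAddCommGroup X] [NormedSpace ℝ X]
    (L : E3 →L[ℝ] X) (w : E3) : L w = ∑ i, w i • L (EuclideanSpace.single i 1) := by
  conv_lhs => rw [eq_sum_smul_single w]
  simp

lemma partialD_eq {F : E3 → E3} {x : E3} (hF : DifferentiableAt ℝ F x) (i j : Fin 3) :
    partialD i F j x = fderiv ℝ (fun y => F y j) x (EuclideanSpace.single i 1) := by
  have h : HasFDerivAt (fun y => F y j)
      ((EuclideanSpace.proj j : E3 →L[ℝ] ℝ).comp (fderiv ℝ F x)) x :=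
    (EuclideanSpace.proj j : E3 →L[ℝ] ℝ).hasFDerivAt.comp x hF.hasFDerivAt
  rw [h.fderiv]
  rfl

lemma divergence_smul {f : E3 → ℝ} {G : E3 → E3} {x : E3}
    (hf : DifferentiableAt ℝ f x) (hG : DifferentiableAt ℝ G x) :
    divergence (fun y => f y • G y) x = f x * divergence G x + fderiv ℝ f x (G x) := by
  have h : fderiv ℝ (fun y => f y • G y) x = _ := fderiv_fun_smul hf hG
  rw [fderiv_apply_eq_sum (fderiv ℝ f x) (G x)]
  simp only [divergence, partialD, h, Finset.mul_sum, ← Finset.sum_add_distrib]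
  refine Finset.sum_congr rfl fun i _ => ?_
  simp
  ring

lemma divergence_congr {F G : E3 → E3} {x : E3} (h : F =ᶠ[𝓝 x] G) :
    divergence F x = divergence G x := by
  simp only [divergence, partialD, h.fderiv_eq]

lemma divergence_eq_zero_of_eventuallyEq {F : E3 → E3} {x : E3} (h : F =ᶠ[𝓝 x] 0) :
    divergence F x = 0 := by
  rw [divergence_congr h]
  simp [divergence, partialD]

lemma continuousOn_divergence {F : E3 → E3} {W : Set E3} (hW : IsOpen W)
    (hF : ContDiffOn ℝ 1 F W) : ContinuousOn (divergence F) W := by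
  have h := hF.continuousOn_fderiv_of_isOpen hW le_rfl
  refine continuousOn_finsetSum _ fun i _ => ?_
  exact (EuclideanSpace.proj i : E3 →L[ℝ] ℝ).continuous.comp_continuousOn
    (h.clm_apply continuousOn_const)

lemma integral_divergence_eq_zero {H : E3 → E3} (hH : ContDiff ℝ 1 H)
    (hc : HasCompactSupport H) : ∫ x, divergence H x = 0 := by
  have hd : Differentiable ℝ H := hH.differentiable one_ne_zero
  have hcoord : ∀ i : Fin 3, ContDiff ℝ 1 (fun y => H y i) := fun i =>
    (EuclideanSpace.proj i : E3 →L[ℝ] ℝ).contDiff.comp hH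
  have hcs : ∀ i : Fin 3, HasCompactSupport (fun y => H y i) := fun i =>
    hc.comp_left (g := fun v : E3 => v i) rfl
  have hcont : ∀ i : Fin 3, Continuous (fun x =>
      fderiv ℝ (fun y => H y i) x (EuclideanSpace.single i 1)) := fun i =>
    ((hcoord i).continuous_fderiv one_ne_zero).clm_apply continuous_const
  have hint : ∀ i : Fin 3, Integrable (fun x =>
      fderiv ℝ (fun y => H y i) x (EuclideanSpace.single i 1)) := fun i =>
    (hcont i).integrable_of_hasCompactSupport ((hcs i).fderiv_apply ℝ _)
  have hdiv : (fun x => divergence H x) = fun x => ∑ i : Fin 3,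
      fderiv ℝ (fun y => H y i) x (EuclideanSpace.single i 1) := by
    ext x
    exact Finset.sum_congr rfl fun i _ => partialD_eq (hd x) i i
  rw [hdiv, integral_finsetSum _ fun i _ => hint i]
  refine Finset.sum_eq_zero fun i _ => ?_
  have := integral_mul_fderiv_eq_neg_fderiv_mul_of_integrable (μ := (volume : Measure E3))
    (f := fun _ => (1 : ℝ)) (g := fun y => H y i)
    (v := (EuclideanSpace.single i 1 : E3)) (by simp) (by simpa using hint i)
    (by simpa using (hcoord i).continuous.integrable_of_hasCompactSupport (hcs i))
    (fun x _ => differentiableAt_const _)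
    (fun x _ => (hcoord i).differentiable one_ne_zero x)
  simpa using this

/-- The divergence of a field that vanishes outside a compact subset of the open set `M`
integrates to zero over `M`. -/
lemma setIntegral_divergence_eq_zero {M K : Set E3} (hM : IsOpen M) (hK : IsCompact K)
    (hKM : K ⊆ M) {H : E3 → E3} (hH : ContDiffOn ℝ 1 H M) (h0 : ∀ x ∈ M, x ∉ K → H x = 0) :
    ∫ x in M, divergence H x = 0 := by
  have hout : ∀ x ∉ K, M.indicator H =ᶠ[𝓝 x] 0 := by
    intro x hx
    filter_upwards [hK.isClosed.isOpen_compl.mem_nhds hx] with y hy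
    by_cases hyM : y ∈ M
    · simp [hyM, h0 y hyM hy]
    · simp [hyM]
  have hin : ∀ x ∈ M, M.indicator H =ᶠ[𝓝 x] H := by
    intro x hx
    filter_upwards [hM.mem_nhds hx] with y hy
    simp [hy]
  have hsmooth : ContDiff ℝ 1 (M.indicator H) := by
    rw [contDiff_iff_contDiffAt]
    intro x
    by_cases hx : x ∈ K
    · exact (hH.contDiffAt (hM.mem_nhds (hKM hx))).congr_of_eventuallyEq (hin x (hKM hx))
    · exact contDiffAt_const.congr_of_eventuallyEq (hout x hx)
  have hcs : HasCompactSupport (M.indicator H) :=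
    HasCompactSupport.intro hK fun x hx => (hout x hx).eq_of_nhds
  rw [← integral_divergence_eq_zero hsmooth hcs, ← integral_indicator hM.measurableSet]
  congr 1
  ext x
  by_cases hx : x ∈ M
  · simp only [hx, indicator_of_mem]
    exact (divergence_congr (hin x hx)).symm
  · simp only [hx, not_false_eq_true, indicator_of_notMem]
    exact (divergence_eq_zero_of_eventuallyEq (hout x fun h => hx (hKM h))).symm

/-! ### A covering by small balls -/

lemma exists_finite_ball_cover {S : Set E3} (hS : IsCompact S)
    (h0 : Measure.hausdorffMeasure 2 S = 0) {ε : ℝ} (hε : 0 < ε) :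
    ∃ (s : Finset ℕ) (c : ℕ → E3) (r : ℕ → ℝ), (∀ i ∈ s, 0 < r i ∧ r i ≤ 1) ∧
      S ⊆ ⋃ i ∈ s, ball (c i) (r i) ∧ ∑ i ∈ s, r i ^ 2 ≤ ε := by
  obtain ⟨δ, hδ0, l, hl, hlε⟩ := posSumOfEncodable
    (show (0 : ℝ) < min (ε / 4) (1 / 2) by positivity) ℕ
  have hδ1 : ∀ i, δ i ≤ 1 / 2 := fun i =>
    (le_hasSum hl i fun j _ => (hδ0 j).le).trans (hlε.trans (min_le_right _ _))
  rw [Measure.hausdorffMeasure_apply] at h0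
  have h1 : (⨅ (t : ℕ → Set E3) (_ : S ⊆ ⋃ n, t n) (_ : ∀ n, ediam (t n) ≤ ENNReal.ofReal (1 / 2)),
      ∑' n, ⨆ _ : (t n).Nonempty, ediam (t n) ^ (2 : ℝ)) < ENNReal.ofReal (ε / 4) := by
    refine lt_of_le_of_lt ?_ (ENNReal.ofReal_pos.2 (by positivity : 0 < ε / 4))
    rw [← h0]
    exact le_iSup₂_of_le (ENNReal.ofReal (1 / 2)) (ENNReal.ofReal_pos.2 (by norm_num)) le_rfl
  simp only [iInf_lt_iff] at h1
  obtain ⟨t, hSt, htd, hsum⟩ := h1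
  have htop : ∀ n, ediam (t n) ≠ ⊤ := fun n => ne_top_of_le_ne_top ENNReal.ofReal_ne_top (htd n)
  have hd : ∀ n, diam (t n) ≤ 1 / 2 := fun n =>
    ENNReal.toReal_le_of_le_ofReal (by norm_num) (htd n)
  have hterm : ∀ n, ENNReal.ofReal (diam (t n) ^ 2) ≤
      ⨆ _ : (t n).Nonempty, ediam (t n) ^ (2 : ℝ) := by
    intro n
    rcases (t n).eq_empty_or_nonempty with h | h
    · simp [h]
    · refine le_iSup_of_le h ?_
      rw [ENNReal.ofReal_pow diam_nonneg, diam, ENNReal.ofReal_toReal (htop n)]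
      norm_num
  classical
  let c : ℕ → E3 := fun n => if h : (t n).Nonempty then h.some else 0
  have hcover : S ⊆ ⋃ i, ball (c i) (diam (t i) + δ i) := by
    intro x hx
    obtain ⟨i, hi⟩ := mem_iUnion.1 (hSt hx)
    have hne : (t i).Nonempty := ⟨x, hi⟩
    refine mem_iUnion.2 ⟨i, ?_⟩
    rw [mem_ball]
    have : c i ∈ t i := by simpa [c, hne] using hne.some_mem
    have h2 := dist_le_diam_of_mem' (htop i) hi this
    linarith [hδ0 i]
  obtain ⟨s, hs⟩ := hS.elim_finite_subcover _ (fun i => isOpen_ball) hcover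
  refine ⟨s, c, fun i => diam (t i) + δ i, fun i _ => ⟨?_, ?_⟩, hs, ?_⟩
  · linarith [hδ0 i, diam_nonneg (s := t i)]
  · linarith [hδ1 i, hd i]
  · have h3 : ∑ i ∈ s, diam (t i) ^ 2 ≤ ε / 4 := by
      have : ENNReal.ofReal (∑ i ∈ s, diam (t i) ^ 2) ≤ ENNReal.ofReal (ε / 4) := by
        rw [ENNReal.ofReal_sum_of_nonneg fun i _ => sq_nonneg _]
        exact ((Finset.sum_le_sum fun i _ => hterm i).trans (ENNReal.sum_le_tsum s)).trans hsum.le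
      exact (ENNReal.ofReal_le_ofReal_iff (by positivity)).1 this
    have h4 : ∑ i ∈ s, δ i ≤ ε / 4 :=
      (sum_le_hasSum s (fun i _ => (hδ0 i).le) hl).trans (hlε.trans (min_le_left _ _))
    calc ∑ i ∈ s, (diam (t i) + δ i) ^ 2 ≤ ∑ i ∈ s, (2 * diam (t i) ^ 2 + 2 * δ i) := by
          refine Finset.sum_le_sum fun i _ => ?_
          nlinarith [sq_nonneg (diam (t i) - δ i), hδ0 i, hδ1 i]
      _ = 2 * ∑ i ∈ s, diam (t i) ^ 2 + 2 * ∑ i ∈ s, δ i := by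
          rw [Finset.sum_add_distrib, Finset.mul_sum, Finset.mul_sum]
      _ ≤ ε := by linarith

/-! ### Cutoff functions -/

/-- Cutoff functions at all scales, with the natural bound for the gradient. -/
lemma exists_bump : ∃ C : ℝ, 0 ≤ C ∧ ∀ (c : E3) (r : ℝ), 0 < r → ∃ η : E3 → ℝ,
    ContDiff ℝ 1 η ∧ (∀ y, 0 ≤ η y ∧ η y ≤ 1) ∧ (∀ y ∈ ball c r, η y = 1) ∧
    (∀ y ∉ closedBall c (2 * r), η y = 0) ∧
    ∀ y, ‖fderiv ℝ η y‖ ≤ (closedBall c (2 * r)).indicator (fun _ => C / r) y := by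
  let b : ContDiffBump (0 : E3) := ⟨1, 2, one_pos, one_lt_two⟩
  have hb : ContDiff ℝ 1 b := b.contDiff
  obtain ⟨C, hC⟩ := (hb.continuous_fderiv one_ne_zero).bounded_above_of_compact_support
    (b.hasCompactSupport.fderiv ℝ)
  have hC0 : 0 ≤ C := (norm_nonneg _).trans (hC 0)
  refine ⟨C, hC0, fun c r hr => ?_⟩
  have hmap : ∀ y, HasFDerivAt (fun y : E3 => r⁻¹ • (y - c))
      (r⁻¹ • ContinuousLinearMap.id ℝ E3) y := fun y =>
    ((hasFDerivAt_id y).sub_const c).const_smul r⁻¹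
  have hnorm : ∀ y : E3, ‖r⁻¹ • (y - c)‖ = dist y c / r := fun y => by
    rw [norm_smul, norm_inv, Real.norm_of_nonneg hr.le, dist_eq_norm]
    field_simp
  have hzero : ∀ y ∉ closedBall c (2 * r), b (r⁻¹ • (y - c)) = 0 := fun y hy => by
    apply b.zero_of_le_dist
    rw [dist_zero_right, hnorm, le_div_iff₀ hr]
    exact (not_le.1 hy).le
  refine ⟨fun y => b (r⁻¹ • (y - c)), hb.comp (by fun_prop),
    fun y => ⟨b.nonneg, b.le_one⟩, fun y hy => ?_, hzero, fun y => ?_⟩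
  · apply b.one_of_mem_closedBall
    rw [mem_closedBall, dist_zero_right, hnorm, div_le_iff₀ hr]
    simpa [b] using (mem_ball.1 hy).le
  · by_cases hy : y ∈ closedBall c (2 * r)
    · rw [indicator_of_mem hy]
      have h := ((hb.differentiable one_ne_zero (r⁻¹ • (y - c))).hasFDerivAt).comp y (hmap y)
      rw [show (fun y => b (r⁻¹ • (y - c))) = b ∘ (fun y : E3 => r⁻¹ • (y - c)) from rfl, h.fderiv]
      rw [ContinuousLinearMap.comp_smul, ContinuousLinearMap.comp_id, norm_smul, norm_inv,
        Real.norm_of_nonneg hr.le, div_eq_inv_mul]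
      exact mul_le_mul_of_nonneg_left (hC _) (by positivity)
    · rw [indicator_of_notMem hy]
      have : (fun y => b (r⁻¹ • (y - c))) =ᶠ[𝓝 y] fun _ => 0 := by
        filter_upwards [isClosed_closedBall.isOpen_compl.mem_nhds hy] with z hz using hzero z hz
      rw [this.fderiv_eq]
      simp

/-- A cutoff function vanishing on finitely many balls. -/
lemma exists_cutoff : ∃ C : ℝ, 0 ≤ C ∧ ∀ (s : Finset ℕ) (c : ℕ → E3) (r : ℕ → ℝ),
    (∀ i ∈ s, 0 < r i) → ∃ χ : E3 → ℝ, ContDiff ℝ 1 χ ∧ (∀ y, 0 ≤ χ y ∧ χ y ≤ 1) ∧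
      (∀ y ∈ ⋃ i ∈ s, ball (c i) (r i), χ y = 0) ∧
      (∀ y, 1 - χ y ≤ ∑ i ∈ s, (closedBall (c i) (2 * r i)).indicator (fun _ => 1) y) ∧
      ∀ y, ‖fderiv ℝ χ y‖ ≤
        ∑ i ∈ s, (closedBall (c i) (2 * r i)).indicator (fun _ => C / r i) y := by
  obtain ⟨C, hC, hbump⟩ := exists_bump
  refine ⟨C, hC, fun s c r => ?_⟩
  induction s using Finset.induction_on with
  | empty => exact fun _ => ⟨fun _ => 1, contDiff_const, by simp, by simp, by simp, by simp⟩
  | insert i s hi ih =>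
    intro hr
    obtain ⟨χ, hχ, hχ01, hχ0, hχ1, hχd⟩ := ih fun j hj => hr j (Finset.mem_insert_of_mem hj)
    obtain ⟨η, hη, hη01, hη1, hη0, hηd⟩ := hbump (c i) (r i) (hr i (Finset.mem_insert_self i s))
    refine ⟨fun y => χ y * (1 - η y), hχ.mul (contDiff_const.sub hη), fun y => ⟨?_, ?_⟩, ?_, ?_, ?_⟩
    · exact mul_nonneg (hχ01 y).1 (by linarith [(hη01 y).2])
    · exact mul_le_one₀ (hχ01 y).2 (by linarith [(hη01 y).2]) (by linarith [(hη01 y).1])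
    · intro y hy
      rw [Finset.set_biUnion_insert] at hy
      rcases hy with hy | hy
      · simp [hη1 y hy]
      · simp [hχ0 y hy]
    · intro y
      rw [Finset.sum_insert hi]
      have h1 : η y ≤ (closedBall (c i) (2 * r i)).indicator (fun _ => (1 : ℝ)) y := by
        by_cases hy : y ∈ closedBall (c i) (2 * r i)
        · simpa [hy] using (hη01 y).2
        · simp [hy, hη0 y hy]
      have h2 : χ y * η y ≤ η y := mul_le_of_le_one_left (hη01 y).1 (hχ01 y).2
      linarith [hχ1 y]
    · intro y
      rw [Finset.sum_insert hi]
      have hd : HasFDerivAt (fun y => χ y * (1 - η y))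
          (χ y • (0 - fderiv ℝ η y) + (1 - η y) • fderiv ℝ χ y) y :=
        (hχ.differentiable one_ne_zero y).hasFDerivAt.mul
          ((hasFDerivAt_const 1 y).sub (hη.differentiable one_ne_zero y).hasFDerivAt)
      rw [hd.fderiv]
      refine (norm_add_le _ _).trans (add_le_add ?_ ?_)
      · rw [norm_smul, zero_sub, norm_neg, Real.norm_of_nonneg (hχ01 y).1]
        exact (mul_le_of_le_one_left (norm_nonneg _) (hχ01 y).2).trans (hηd y)
      · rw [norm_smul, Real.norm_of_nonneg (by linarith [(hη01 y).2])]
        exact (mul_le_of_le_one_left (norm_nonneg _) (by linarith [(hη01 y).1])).trans (hχd y)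

/-- A smooth step function. -/
lemma exists_step : ∃ (θ : ℝ → ℝ) (C : ℝ), ContDiff ℝ 1 θ ∧ (∀ s ≤ -2, θ s = 1) ∧
    (∀ s, -1 ≤ s → θ s = 0) ∧ (∀ s, |θ s| ≤ 1) ∧ ∀ s, |deriv θ s * s| ≤ C := by
  have hθ : ContDiff ℝ 1 (fun s : ℝ => Real.smoothTransition (-s - 1)) :=
    Real.smoothTransition.contDiff.comp (contDiff_neg.sub contDiff_const)
  have hcont : Continuous (fun s => deriv (fun s : ℝ => Real.smoothTransition (-s - 1)) s * s) :=
    (hθ.continuous_deriv le_rfl).mul continuous_id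
  have hcs : HasCompactSupport
      (fun s => deriv (fun s : ℝ => Real.smoothTransition (-s - 1)) s * s) := by
    refine HasCompactSupport.intro (isCompact_Icc (a := (-2 : ℝ)) (b := -1)) fun s hs => ?_
    have : deriv (fun s : ℝ => Real.smoothTransition (-s - 1)) s = 0 := by
      rcases lt_or_ge s (-2) with h | h
      · have : (fun s : ℝ => Real.smoothTransition (-s - 1)) =ᶠ[𝓝 s] fun _ => 1 := by
          filter_upwards [Iio_mem_nhds h] with x hx
          exact Real.smoothTransition.one_of_one_le (by linarith [mem_Iio.1 hx])
        rw [this.deriv_eq]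
        simp
      · have h2 : -1 < s := by
          by_contra h3
          exact hs ⟨h, not_lt.1 h3⟩
        have : (fun s : ℝ => Real.smoothTransition (-s - 1)) =ᶠ[𝓝 s] fun _ => 0 := by
          filter_upwards [Ioi_mem_nhds h2] with x hx
          exact Real.smoothTransition.zero_of_nonpos (by linarith [mem_Ioi.1 hx])
        rw [this.deriv_eq]
        simp
    rw [this, zero_mul]
  obtain ⟨C, hC⟩ := hcont.bounded_above_of_compact_support hcs
  refine ⟨_, C, hθ, fun s hs => Real.smoothTransition.one_of_one_le (by linarith),
    fun s hs => Real.smoothTransition.zero_of_nonpos (by linarith), fun s => ?_, hC⟩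
  rw [abs_of_nonneg (Real.smoothTransition.nonneg _)]
  exact Real.smoothTransition.le_one _

/-! ### Tangent fields near a smooth boundary point -/

/-- The field `G` is tangent to the boundary of `M` at its smooth points. -/
def IsTangent (M : Set E3) (G : E3 → E3) : Prop :=
  ∀ x n : E3, IsOuterUnitNormal M x n → inner ℝ n (G x) = 0

lemma IsLocalDefiningFunction.contDiffAt {M : Set E3} {p : E3} {g : E3 → ℝ}
    (hg : IsLocalDefiningFunction M p g) : ContDiffAt ℝ ∞ g p := by
  obtain ⟨U, hU, hpU, hgU, -, -⟩ := hg
  exact hgU.contDiffAt (hU.mem_nhds hpU)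

lemma fderiv_ne_zero_iff_gradient {g : E3 → ℝ} {x : E3} :
    gradient g x ≠ 0 ↔ fderiv ℝ g x ≠ 0 := by
  simp [gradient]

lemma IsLocalDefiningFunction.eventually {M : Set E3} {p : E3} {g : E3 → ℝ}
    (hg : IsLocalDefiningFunction M p g) : ∀ᶠ x in 𝓝 p, IsLocalDefiningFunction M x g := by
  have hc : ContinuousAt (fderiv ℝ g) p :=
    (hg.contDiffAt.fderiv_right (m := 0) (by simp)).continuousAt
  obtain ⟨U, hU, hpU, hgU, hne, hMU⟩ := hg
  filter_upwards [hU.mem_nhds hpU, hc.eventually_ne (fderiv_ne_zero_iff_gradient.1 hne)] with x hx hx'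
  exact ⟨U, hU, hx, hgU, fderiv_ne_zero_iff_gradient.2 hx', hMU⟩

lemma IsTangent.fderiv_eq_zero {M : Set E3} {G : E3 → E3} (hG : IsTangent M G) {x : E3}
    {g : E3 → ℝ} (hx : x ∈ frontier M) (hg : IsLocalDefiningFunction M x g) :
    fderiv ℝ g x (G x) = 0 := by
  have h := hG x _ ⟨hx, g, hg, rfl⟩
  obtain ⟨U, hU, hpU, hgU, hne, hMU⟩ := hg
  rw [real_inner_smul_left, inner_gradient_left] at h
  exact (mul_eq_zero.1 h).resolve_left (inv_ne_zero (norm_ne_zero_iff.2 hne))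

lemma exists_mem_frontier_of_isPreconnected {X : Type*} [TopologicalSpace X] {M s : Set X}
    (hM : IsOpen M) (hs : IsPreconnected s) (h1 : (s ∩ M).Nonempty) (h2 : (s ∩ Mᶜ).Nonempty) :
    ∃ z ∈ s, z ∈ frontier M := by
  by_contra! h
  have hcl : ∀ z ∈ s, z ∈ M ∨ z ∈ (closure M)ᶜ := fun z hz => by
    have := h z hz
    rw [hM.frontier_eq] at this
    by_contra! h3
    exact this ⟨not_not.1 h3.2, h3.1⟩
  obtain ⟨y, hys, hyM⟩ := h2
  obtain ⟨z, -, hz1, hz2⟩ := hs M (closure M)ᶜ hM isClosed_closure.isOpen_compl hcl h1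
    ⟨y, hys, (hcl y hys).resolve_left hyM⟩
  exact hz2 (subset_closure hz1)

/-- The normal component of a tangent field vanishes to first order at the boundary. -/
lemma exists_ball_abs_fderiv_le {M : Set E3} (hM : IsOpen M) {G : E3 → E3} (hG : IsTangent M G)
    {p : E3} (hp : p ∈ frontier M) (hGp : ContDiffAt ℝ 1 G p) {g : E3 → ℝ}
    (hg : IsLocalDefiningFunction M p g) :
    ∃ r > 0, ∃ C : ℝ, (∀ y ∈ ball p r, ContDiffAt ℝ 1 g y ∧ (y ∈ M ↔ g y < 0)) ∧
      ∀ y ∈ ball p r, y ∈ M → |fderiv ℝ g y (G y)| ≤ C * |g y| := by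
  have hev := hg.eventually
  have hgp := hg.contDiffAt
  have hdc : ContDiffAt ℝ 1 (fderiv ℝ g) p := hgp.fderiv_right (by norm_cast)
  obtain ⟨K, t, ht, hLip⟩ := (hdc.clm_apply hGp).exists_lipschitzOnWith
  obtain ⟨U, hU, hpU, hgU, hne, hMU⟩ := hg
  have hmem : ∀ y ∈ U, (y ∈ M ↔ g y < 0) := fun y hy => by
    have := Set.ext_iff.1 hMU y
    simp only [mem_inter_iff, hy, and_true, mem_ofPred_eq, true_and] at this
    exact this
  obtain ⟨ν, hν⟩ : ∃ ν : E3, fderiv ℝ g p ν = 1 := by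
    obtain ⟨v, hv⟩ := ContinuousLinearMap.exists_ne_zero (fderiv_ne_zero_iff_gradient.1 hne)
    exact ⟨(fderiv ℝ g p v)⁻¹ • v, by simp [hv]⟩
  have hν0 : 0 < ‖ν‖ := by
    rw [norm_pos_iff]
    rintro rfl
    simp at hν
  have hderiv : ∀ᶠ y in 𝓝 p, (1 / 2 : ℝ) < fderiv ℝ g y ν := by
    have : ContinuousAt (fun y => fderiv ℝ g y ν) p := hdc.continuousAt.clm_apply continuousAt_const
    exact this.eventually (lt_mem_nhds (by simp only [hν]; norm_num))
  have hgp0 : g p = 0 := by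
    apply le_antisymm
    · have hcl : p ∈ closure M := hp.1
      by_contra h
      have : ∀ᶠ y in 𝓝 p, 0 < g y := hgp.continuousAt.eventually (lt_mem_nhds (not_le.1 h))
      obtain ⟨y, hy, hyM⟩ := mem_closure_iff_nhds.1 hcl _ (this.and (hU.mem_nhds hpU))
      exact lt_asymm hy.1 ((hmem y hy.2).1 hyM)
    · rw [← not_lt, ← hmem p hpU]
      rw [hM.frontier_eq] at hp
      exact hp.2
  obtain ⟨r₀, hr₀, hball⟩ := Metric.eventually_nhds_iff_ball.1
    ((Filter.Eventually.and (hU.mem_nhds hpU) ht).and (hderiv.and hev))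
  have hsmall : ∀ᶠ y in 𝓝 p, |g y| < r₀ / (4 * ‖ν‖) := by
    have : ContinuousAt (fun y => |g y|) p := hgp.continuousAt.abs
    exact this.eventually (gt_mem_nhds (by simp only [hgp0, abs_zero]; positivity))
  obtain ⟨r₁, hr₁, hball₁⟩ := Metric.eventually_nhds_iff_ball.1 hsmall
  refine ⟨min r₁ (r₀ / 2), by positivity, K * (2 * ‖ν‖), fun y hy => ?_, fun y hy hyM => ?_⟩
  · have hyU : y ∈ U := (hball y (ball_subset_ball ((min_le_right _ _).trans (by linarith)) hy)).1.1
    exact ⟨(hgU.contDiffAt (hU.mem_nhds hyU)).of_le (by norm_cast), hmem y hyU⟩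
  have hya := hball₁ y (ball_subset_ball (min_le_left _ _) hy)
  have hyd : dist y p < r₀ / 2 := lt_of_lt_of_le hy (min_le_right _ _)
  have hyU : y ∈ U := (hball y (by rw [mem_ball]; linarith)).1.1
  have hg0 : g y < 0 := (hmem y hyU).1 hyM
  set a := |g y| with ha
  have hag : g y = -a := by rw [ha, abs_of_neg hg0]; ring
  have ha0 : 0 < a := by linarith
  have hav : a * (4 * ‖ν‖) < r₀ := by rwa [lt_div_iff₀ (by positivity)] at hya
  have hpath : ∀ τ ∈ Icc (0 : ℝ) (2 * a), y + τ • ν ∈ ball p r₀ := fun τ hτ => by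
    rw [mem_ball]
    have h1 : dist (y + τ • ν) y = τ * ‖ν‖ := by
      rw [dist_eq_norm, add_sub_cancel_left, norm_smul, Real.norm_of_nonneg hτ.1]
    have h2 : τ * ‖ν‖ ≤ 2 * a * ‖ν‖ := by gcongr; exact hτ.2
    linarith [dist_triangle (y + τ • ν) y p]
  have hend : y + (2 * a) • ν ∉ M := by
    have hmemE := hpath (2 * a) ⟨by positivity, le_rfl⟩
    rw [hmem _ (hball _ hmemE).1.1, not_lt]
    have hder : ∀ τ ∈ Icc (0 : ℝ) (2 * a),
        HasDerivAt (fun τ : ℝ => g (y + τ • ν)) (fderiv ℝ g (y + τ • ν) ν) τ := fun τ hτ => by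
      have hd : DifferentiableAt ℝ g (y + τ • ν) :=
        (hgU.contDiffAt (hU.mem_nhds (hball _ (hpath τ hτ)).1.1)).differentiableAt (by simp)
      have hl : HasDerivAt (fun τ : ℝ => y + τ • ν) ν τ := by
        simpa using ((hasDerivAt_id τ).smul_const ν).const_add y
      exact hd.hasFDerivAt.comp_hasDerivAt τ hl
    have := (convex_Icc (0 : ℝ) (2 * a)).mul_sub_le_image_sub_of_le_deriv
      (f := fun τ : ℝ => g (y + τ • ν)) (C := 1 / 2)
      (fun τ hτ => (hder τ hτ).continuousAt.continuousWithinAt)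
      (fun τ hτ => (hder τ (interior_subset hτ)).differentiableAt.differentiableWithinAt)
      (fun τ hτ => by
        rw [(hder τ (interior_subset hτ)).deriv]
        exact (hball _ (hpath τ (interior_subset hτ))).2.1.le)
      0 ⟨le_rfl, by positivity⟩ (2 * a) ⟨by positivity, le_rfl⟩ (by positivity)
    simp only [zero_smul, add_zero] at this
    linarith
  obtain ⟨z, ⟨τ, hτ, rfl⟩, hzf⟩ :=
    exists_mem_frontier_of_isPreconnected hM (isPreconnected_Icc.image (fun τ : ℝ => y + τ • ν)
      (by fun_prop : ContinuousOn (fun τ : ℝ => y + τ • ν) (Icc 0 (2 * a))))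
      ⟨y, ⟨0, ⟨le_rfl, by positivity⟩, by simp⟩, hyM⟩
      ⟨_, ⟨2 * a, ⟨by positivity, le_rfl⟩, rfl⟩, hend⟩
  have hz := hball _ (hpath τ hτ)
  have hy0 := hball y (by rw [mem_ball]; linarith)
  have h1 := hLip.dist_le_mul y hy0.1.2 _ hz.1.2
  simp only [hG.fderiv_eq_zero hzf hz.2.2, Real.dist_eq, sub_zero] at h1
  refine h1.trans ?_
  rw [mul_assoc]
  refine mul_le_mul_of_nonneg_left ?_ K.coe_nonneg
  rw [dist_comm, dist_eq_norm, add_sub_cancel_left, norm_smul, Real.norm_of_nonneg hτ.1]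
  have : τ * ‖ν‖ ≤ 2 * a * ‖ν‖ := by gcongr; exact hτ.2
  linarith

/-! ### The divergence theorem for tangent fields -/

section DivergenceTheorem

variable {M W : Set E3} {G : E3 → E3} {f : E3 → ℝ}

lemma eventuallyEq_zero_of_notMem_tsupport {x : E3} (hx : x ∉ tsupport f) :
    f =ᶠ[𝓝 x] 0 := notMem_tsupport_iff_eventuallyEq.1 hx

lemma divergence_smul_eq_zero {x : E3} (hx : x ∉ tsupport f) :
    divergence (fun y => f y • G y) x = 0 := by
  apply divergence_eq_zero_of_eventuallyEq
  filter_upwards [eventuallyEq_zero_of_notMem_tsupport hx] with y hy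
  simp [hy]

lemma integrableOn_of_continuousOn_of_zero {X : Type*} [NormedAddCommGroup X] {h : E3 → X}
    {K : Set E3} (hM : IsOpen M) (hMW : closure M ⊆ W) (hK : IsCompact K) (hh : ContinuousOn h W)
    (h0 : ∀ x ∉ K, h x = 0) : IntegrableOn h M := by
  have hc : IsCompact (K ∩ closure M) := hK.inter_right isClosed_closure
  have : IntegrableOn h (K ∩ closure M) :=
    (hh.mono (inter_subset_right.trans hMW)).integrableOn_compact hc
  refine this.of_forall_sdiff_eq_zero hM.measurableSet fun x hx => h0 x fun hxK => ?_
  exact hx.2 ⟨hxK, subset_closure hx.1⟩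

lemma exists_bound_of_continuousOn_of_zero {X : Type*} [NormedAddCommGroup X] {h : E3 → X}
    {K : Set E3} (hMW : closure M ⊆ W) (hK : IsCompact K) (hh : ContinuousOn h W)
    (h0 : ∀ x ∉ K, h x = 0) : ∃ A : ℝ, 0 ≤ A ∧ ∀ x ∈ M, ‖h x‖ ≤ A := by
  have hc : IsCompact (K ∩ closure M) := hK.inter_right isClosed_closure
  obtain ⟨A, hA⟩ := hc.exists_bound_of_continuousOn (hh.mono (inter_subset_right.trans hMW))
  refine ⟨max A 0, le_max_right _ _, fun x hx => ?_⟩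
  by_cases hxK : x ∈ K
  · exact (hA x ⟨hxK, subset_closure hx⟩).trans (le_max_left _ _)
  · rw [h0 x hxK, norm_zero]
    exact le_max_right _ _

lemma integrableOn_divergence_smul (hM : IsOpen M) (hW : IsOpen W) (hMW : closure M ⊆ W)
    (hG : ContDiffOn ℝ 1 G W) (hf : ContDiff ℝ 1 f) (hfc : HasCompactSupport f) :
    IntegrableOn (divergence (fun y => f y • G y)) M :=
  integrableOn_of_continuousOn_of_zero hM hMW hfc
    (continuousOn_divergence hW (hf.contDiffOn.smul hG)) fun _ => divergence_smul_eq_zero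

/-- The field `G` has vanishing flux out of `M` when tested with functions supported in `V`. -/
def HasZeroFlux (M : Set E3) (G : E3 → E3) (V : Set E3) : Prop :=
  ∀ f : E3 → ℝ, ContDiff ℝ 1 f → HasCompactSupport f → tsupport f ⊆ V →
    ∫ x in M, divergence (fun y => f y • G y) x = 0

lemma hasZeroFlux_of_subset (hM : IsOpen M) (hMW : closure M ⊆ W) (hG : ContDiffOn ℝ 1 G W) :
    HasZeroFlux M G M := fun f hf hfc hfV =>
  setIntegral_divergence_eq_zero hM hfc hfV
    (hf.contDiffOn.smul (hG.mono (subset_closure.trans hMW)))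
    fun x _ hx => by simp [image_eq_zero_of_notMem_tsupport hx]

lemma hasZeroFlux_of_disjoint (hM : IsOpen M) : HasZeroFlux M G (closure M)ᶜ :=
  fun f hf hfc hfV => by
    rw [setIntegral_congr_fun hM.measurableSet (g := fun _ => (0 : ℝ)), integral_zero]
    exact fun x hx => divergence_smul_eq_zero fun h => hfV h (subset_closure hx)

lemma hasZeroFlux_near_smooth_point (hM : IsOpen M) (hW : IsOpen W) (hMW : closure M ⊆ W)
    (hG : ContDiffOn ℝ 1 G W) (ht : IsTangent M G) {p : E3} (hp : p ∈ frontier M) {g : E3 → ℝ}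
    (hg : IsLocalDefiningFunction M p g) : ∃ r > 0, HasZeroFlux M G (ball p r) := by
  obtain ⟨r, hr, C, hgr, hC⟩ := exists_ball_abs_fderiv_le hM ht hp
    (hG.contDiffAt (hW.mem_nhds (hMW hp.1))) hg
  refine ⟨r, hr, fun f hf hfc hfV => ?_⟩
  obtain ⟨θ, Cθ, hθ, hθ1, hθ0, hθb, hθd⟩ := exists_step
  have hFW : ContDiffOn ℝ 1 (fun y => f y • G y) W := hf.contDiffOn.smul hG
  have hFd : ∀ y ∈ M, DifferentiableAt ℝ (fun y => f y • G y) y := fun y hy =>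
    (hFW.contDiffAt (hW.mem_nhds (hMW (subset_closure hy)))).differentiableAt one_ne_zero
  let H : ℕ → E3 → E3 := fun n y => θ (g y * (n + 1)) • (f y • G y)
  have hH0 : ∀ n, ∀ y ∉ tsupport f, H n =ᶠ[𝓝 y] 0 := fun n y hy => by
    filter_upwards [eventuallyEq_zero_of_notMem_tsupport hy] with z hz
    simp [H, hz]
  have hθg : ∀ n : ℕ, ∀ y ∈ tsupport f, ContDiffAt ℝ 1 (fun y => θ (g y * (n + 1))) y :=
    fun n y hy => hθ.contDiffAt.comp y ((hgr y (hfV hy)).1.mul contDiffAt_const)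
  have hHM : ∀ n, ContDiffOn ℝ 1 (H n) M := fun n y hy => by
    refine ContDiffAt.contDiffWithinAt ?_
    by_cases hyf : y ∈ tsupport f
    · exact (hθg n y hyf).smul (hFW.contDiffAt (hW.mem_nhds (hMW (subset_closure hy))))
    · exact contDiffAt_const.congr_of_eventuallyEq (hH0 n y hyf)
  have hHint : ∀ n, ∫ x in M, divergence (H n) x = 0 := fun n => by
    have hgc : ContinuousOn (fun y => g y * ((n : ℝ) + 1)) (tsupport f) := fun y hy =>
      ((hgr y (hfV hy)).1.continuousAt.mul continuousAt_const).continuousWithinAt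
    have hK : IsCompact (tsupport f ∩ (fun y => g y * ((n : ℝ) + 1)) ⁻¹' Iic (-1)) :=
      hfc.isCompact.of_isClosed_subset
        (hgc.preimage_isClosed_of_isClosed (isClosed_tsupport f) isClosed_Iic) inter_subset_left
    refine setIntegral_divergence_eq_zero hM hK (fun y hy => ?_) (hHM n) fun y hyM hy => ?_
    · rw [(hgr y (hfV hy.1)).2]
      have h1 : g y * ((n : ℝ) + 1) ≤ -1 := hy.2
      by_contra! h2
      have : 0 ≤ g y * ((n : ℝ) + 1) := by positivity
      linarith
    · by_cases hyf : y ∈ tsupport f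
      · have h1 : -1 < g y * ((n : ℝ) + 1) := by
          by_contra! h
          exact hy ⟨hyf, h⟩
        simp [H, hθ0 _ h1.le]
      · simp [H, image_eq_zero_of_notMem_tsupport hyf]
  obtain ⟨A, hA0, hA⟩ := exists_bound_of_continuousOn_of_zero hMW hfc
    (continuousOn_divergence hW hFW) fun _ => divergence_smul_eq_zero
  obtain ⟨F, hF⟩ := hf.continuous.bounded_above_of_compact_support hfc
  have hCθ : 0 ≤ Cθ := (abs_nonneg _).trans (hθd 0)
  have hbound : ∀ n, ∀ y ∈ M, ‖divergence (H n) y‖ ≤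
      (tsupport f).indicator (fun _ => A + F * (Cθ * C)) y := fun n y hy => by
    by_cases hyf : y ∈ tsupport f
    · rw [indicator_of_mem hyf]
      have hgd : HasFDerivAt g (fderiv ℝ g y) y :=
        ((hgr y (hfV hyf)).1.differentiableAt one_ne_zero).hasFDerivAt
      have hcomp : HasFDerivAt (fun y => θ (g y * ((n : ℝ) + 1)))
          (deriv θ (g y * ((n : ℝ) + 1)) • (((n : ℝ) + 1) • fderiv ℝ g y)) y :=
        (hθ.differentiable one_ne_zero _).hasDerivAt.comp_hasFDerivAt y (hgd.mul_const _)
      have hdiv : divergence (H n) y = _ := divergence_smul hcomp.differentiableAt (hFd y hy)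
      rw [hdiv, hcomp.fderiv]
      refine (norm_add_le _ _).trans (add_le_add ?_ ?_)
      · rw [norm_mul]
        exact (mul_le_of_le_one_left (norm_nonneg _) (hθb _)).trans (hA y hy)
      · have h1 := hC y (hfV hyf) hy
        have h2 := hθd (g y * ((n : ℝ) + 1))
        have hF0 : 0 ≤ F := (norm_nonneg _).trans (hF y)
        simp only [smul_apply, map_smul, smul_eq_mul, Real.norm_eq_abs]
        have hn : (0 : ℝ) < (n : ℝ) + 1 := by positivity
        rw [show f y * (deriv θ (g y * ((n : ℝ) + 1)) * (((n : ℝ) + 1) * fderiv ℝ g y (G y))) =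
          f y * (deriv θ (g y * ((n : ℝ) + 1)) * ((n : ℝ) + 1) * fderiv ℝ g y (G y)) by ring,
          abs_mul]
        refine mul_le_mul (hF y) ?_ (abs_nonneg _) hF0
        have hgy : 0 < |g y| := abs_pos.2 ((hgr y (hfV hyf)).2.1 hy).ne
        have hC0 : 0 ≤ C := by
          by_contra! hneg
          nlinarith [abs_nonneg (fderiv ℝ g y (G y))]
        rw [abs_mul] at h2
        rw [abs_mul, abs_mul]
        rw [abs_mul] at h2
        calc |deriv θ (g y * ((n : ℝ) + 1))| * |(n : ℝ) + 1| * |fderiv ℝ g y (G y)|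
            ≤ |deriv θ (g y * ((n : ℝ) + 1))| * |(n : ℝ) + 1| * (C * |g y|) := by gcongr
          _ = |deriv θ (g y * ((n : ℝ) + 1))| * (|g y| * |(n : ℝ) + 1|) * C := by ring
          _ ≤ Cθ * C := by gcongr
    · rw [divergence_eq_zero_of_eventuallyEq (hH0 n y hyf)]
      simp [hyf]
  have hlim : ∀ y ∈ M, Tendsto (fun n => divergence (H n) y) atTop
      (𝓝 (divergence (fun y => f y • G y) y)) := fun y hy => by
    refine tendsto_const_nhds.congr' ?_
    by_cases hyf : y ∈ tsupport f
    · have hg0 := (hgr y (hfV hyf)).2.1 hy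
      obtain ⟨N, hN⟩ := exists_nat_gt (-(4 / g y))
      filter_upwards [eventually_ge_atTop N] with n hn
      apply divergence_congr
      have hlt : g y < g y / 2 := by linarith
      filter_upwards [(hgr y (hfV hyf)).1.continuousAt.eventually (gt_mem_nhds hlt)] with z hz
      have hn' : (N : ℝ) ≤ n := by exact_mod_cast hn
      have h3 : -(4 / g y) < (n : ℝ) + 1 := by linarith
      have h4 : g z * ((n : ℝ) + 1) ≤ -2 := by
        have h5 : g z * ((n : ℝ) + 1) ≤ g y / 2 * ((n : ℝ) + 1) := by gcongr
        have h6 : g y / 2 * ((n : ℝ) + 1) ≤ g y / 2 * (-(4 / g y)) :=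
          mul_le_mul_of_nonpos_left h3.le (by linarith)
        have h7 : g y / 2 * (-(4 / g y)) = -2 := by
          field_simp [hg0.ne]
          norm_num
        linarith
      simp [H, hθ1 _ h4]
    · refine Eventually.of_forall fun n => ?_
      simp only
      rw [divergence_smul_eq_zero hyf, divergence_eq_zero_of_eventuallyEq (hH0 n y hyf)]
  have htend := tendsto_integral_of_dominated_convergence (μ := volume.restrict M)
    (F := fun n => divergence (H n)) (f := divergence (fun y => f y • G y))
    ((tsupport f).indicator (fun _ => A + F * (Cθ * C)))
    (fun n => (continuousOn_divergence hM (hHM n)).aestronglyMeasurable hM.measurableSet)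
    (((integrableOn_const (hfc.isCompact.measure_lt_top.ne)).integrable_indicator
      (isClosed_tsupport f).measurableSet).integrableOn)
    (fun n => (ae_restrict_iff' hM.measurableSet).2 (Eventually.of_forall (hbound n)))
    ((ae_restrict_iff' hM.measurableSet).2 (Eventually.of_forall hlim))
  simp only [hHint] at htend
  exact tendsto_nhds_unique htend tendsto_const_nhds

/-- Vanishing flux is a local property. -/
lemma hasZeroFlux_of_local (hM : IsOpen M) (hW : IsOpen W) (hMW : closure M ⊆ W)
    (hG : ContDiffOn ℝ 1 G W) :
    HasZeroFlux M G {p | ∃ r > 0, HasZeroFlux M G (ball p r)} := by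
  intro f hf hfc hfV
  have hfV' : ∀ p ∈ tsupport f, ∃ r > 0, HasZeroFlux M G (ball p r) := fun p hp => hfV hp
  choose! r hr hzero using hfV'
  have key : ∀ s : Finset E3, (∀ p ∈ s, p ∈ tsupport f) → ∀ h : E3 → ℝ, ContDiff ℝ 1 h →
      HasCompactSupport h → tsupport h ⊆ ⋃ p ∈ s, ball p (r p / 4) →
      ∫ x in M, divergence (fun y => h y • G y) x = 0 := by
    intro s
    induction s using Finset.induction_on with
    | empty =>
      intro _ h _ _ hs
      rw [setIntegral_congr_fun hM.measurableSet (g := fun _ => (0 : ℝ)), integral_zero]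
      exact fun x hx => divergence_smul_eq_zero fun hx' => by simpa using hs hx'
    | insert p s hp ih =>
      intro hps h hh hhc hs
      have hpr : 0 < r p := hr p (hps p (Finset.mem_insert_self p s))
      let b : ContDiffBump p := ⟨r p / 4, r p / 2, by positivity, by linarith⟩
      have hb : ContDiff ℝ 1 b := b.contDiff
      have hb' : ContDiff ℝ 1 (fun y => 1 - b y) := contDiff_const.sub hb
      have e1 : ContDiff ℝ 1 (fun y => b y * h y) := hb.mul hh
      have e2 : ContDiff ℝ 1 (fun y => (1 - b y) * h y) := hb'.mul hh
      have c1 : HasCompactSupport (fun y => b y * h y) := hhc.mul_left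
      have c2 : HasCompactSupport (fun y => (1 - b y) * h y) := hhc.mul_left
      have i1 : ∫ x in M, divergence (fun y => (b y * h y) • G y) x = 0 := by
        refine hzero p (hps p (Finset.mem_insert_self p s)) _ e1 c1 ?_
        refine (tsupport_mul_subset_left (f := b) (g := h)).trans ?_
        rw [b.tsupport_eq]
        exact closedBall_subset_ball (by simp only [b]; linarith)
      have i2 : ∫ x in M, divergence (fun y => ((1 - b y) * h y) • G y) x = 0 := by
        refine ih (fun q hq => hps q (Finset.mem_insert_of_mem hq)) _ e2 c2 fun x hx => ?_
        have hxh : x ∈ tsupport h := tsupport_mul_subset_right (f := fun y => 1 - b y) hx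
        have := hs hxh
        rw [Finset.set_biUnion_insert] at this
        refine this.resolve_left fun hxb => ?_
        refine notMem_tsupport_iff_eventuallyEq.2 ?_ hx
        filter_upwards [isOpen_ball.mem_nhds hxb] with y hy
        have : b y = 1 := b.one_of_mem_closedBall (ball_subset_closedBall hy)
        simp [this]
      rw [setIntegral_congr_fun hM.measurableSet (g := fun x =>
        divergence (fun y => (b y * h y) • G y) x +
          divergence (fun y => ((1 - b y) * h y) • G y) x), integral_add, i1, i2, add_zero]
      · exact integrableOn_divergence_smul hM hW hMW hG e1 c1
      · exact integrableOn_divergence_smul hM hW hMW hG e2 c2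
      · intro x hx
        have hGd := (hG.contDiffAt (hW.mem_nhds (hMW (subset_closure hx)))).differentiableAt
          one_ne_zero
        have d1 := e1.differentiable one_ne_zero x
        have d2 := e2.differentiable one_ne_zero x
        have hsum : h = fun y => b y * h y + (1 - b y) * h y := by ext y; ring
        simp only
        rw [divergence_smul (hh.differentiable one_ne_zero x) hGd, divergence_smul d1 hGd,
          divergence_smul d2 hGd]
        have : fderiv ℝ h x = fderiv ℝ (fun y => b y * h y) x +
            fderiv ℝ (fun y => (1 - b y) * h y) x := by
          conv_lhs => rw [hsum]
          exact fderiv_fun_add d1 d2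
        rw [this, add_apply]
        ring
  obtain ⟨s, hs, hcov⟩ := hfc.isCompact.elim_nhds_subcover (fun p => ball p (r p / 4))
    fun p hp => ball_mem_nhds p (by have := hr p hp; positivity)
  exact key s hs f hf hfc hcov

/-- The boundary points of `M` which are not smooth. -/
def singularBoundary (M : Set E3) : Set E3 :=
  {x : E3 | x ∈ frontier M ∧ ¬ ∃ g : E3 → ℝ, IsLocalDefiningFunction M x g}

lemma isClosed_singularBoundary : IsClosed (singularBoundary M) := by
  have : singularBoundary M = frontier M ∩ {x | ∃ g, IsLocalDefiningFunction M x g}ᶜ := rfl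
  rw [this]
  refine isClosed_frontier.inter (IsOpen.isClosed_compl ?_)
  rw [isOpen_iff_mem_nhds]
  rintro x ⟨g, hg⟩
  filter_upwards [hg.eventually] with y hy using ⟨g, hy⟩

lemma hasZeroFlux_compl_singularBoundary (hM : IsOpen M) (hW : IsOpen W) (hMW : closure M ⊆ W)
    (hG : ContDiffOn ℝ 1 G W) (ht : IsTangent M G) : HasZeroFlux M G (singularBoundary M)ᶜ := by
  intro f hf hfc hfV
  refine hasZeroFlux_of_local hM hW hMW hG f hf hfc fun p hp => ?_
  by_cases hpM : p ∈ M
  · obtain ⟨r, hr, hrM⟩ := Metric.isOpen_iff.1 hM p hpM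
    exact ⟨r, hr, fun h h1 h2 h3 => hasZeroFlux_of_subset hM hMW hG h h1 h2 (h3.trans hrM)⟩
  by_cases hpc : p ∈ closure M
  · have hpf : p ∈ frontier M := by
      rw [hM.frontier_eq]
      exact ⟨hpc, hpM⟩
    obtain ⟨g, hg⟩ : ∃ g, IsLocalDefiningFunction M p g := by
      by_contra hne
      exact hfV hp ⟨hpf, hne⟩
    exact hasZeroFlux_near_smooth_point hM hW hMW hG ht hpf hg
  · obtain ⟨r, hr, hrM⟩ := Metric.isOpen_iff.1 isClosed_closure.isOpen_compl p hpc
    exact ⟨r, hr, fun h h1 h2 h3 => hasZeroFlux_of_disjoint hM h h1 h2 (h3.trans hrM)⟩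

/-- The divergence theorem for tangent fields on a domain with almost everywhere smooth
boundary. -/
theorem setIntegral_divergence_smul_eq_zero (hM : IsOpen M) (hbdry : HasAESmoothBoundary M)
    (hW : IsOpen W) (hMW : closure M ⊆ W) (hG : ContDiffOn ℝ 1 G W) (ht : IsTangent M G)
    (hf : ContDiff ℝ 1 f) (hfc : HasCompactSupport f) :
    ∫ x in M, divergence (fun y => f y • G y) x = 0 := by
  have hFW : ContDiffOn ℝ 1 (fun y => f y • G y) W := hf.contDiffOn.smul hG
  have hFd : ∀ y ∈ M, DifferentiableAt ℝ (fun y => f y • G y) y := fun y hy =>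
    (hFW.contDiffAt (hW.mem_nhds (hMW (subset_closure hy)))).differentiableAt one_ne_zero
  obtain ⟨A, hA0, hA⟩ := exists_bound_of_continuousOn_of_zero hMW hfc
    (continuousOn_divergence hW hFW) fun _ => divergence_smul_eq_zero
  obtain ⟨A', hA'0, hA'⟩ := exists_bound_of_continuousOn_of_zero hMW hfc hFW.continuousOn
    fun x hx => by simp [image_eq_zero_of_notMem_tsupport hx]
  obtain ⟨C, hC0, hcut⟩ := exists_cutoff
  set κ : ℝ := 8 * volume.real (closedBall (0 : E3) 1) with hκ
  have hκ0 : 0 ≤ κ := by positivity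
  have hS : IsCompact (singularBoundary M ∩ tsupport f) :=
    hfc.isCompact.inter_left isClosed_singularBoundary
  have hS0 : Measure.hausdorffMeasure 2 (singularBoundary M ∩ tsupport f) = 0 :=
    measure_mono_null inter_subset_left hbdry
  have key : ∀ ε > 0, ‖∫ x in M, divergence (fun y => f y • G y) x‖ ≤ (A + C * A') * κ * ε := by
    intro ε hε
    obtain ⟨s, c, r, hr, hcov, hsum⟩ := exists_finite_ball_cover hS hS0 hε
    obtain ⟨χ, hχ, hχ01, hχ0, hχ1, hχd⟩ := hcut s c r fun i hi => (hr i hi).1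
    have hχ' : ContDiff ℝ 1 (fun y => 1 - χ y) := contDiff_const.sub hχ
    have e1 : ContDiff ℝ 1 (fun y => χ y * f y) := hχ.mul hf
    have e2 : ContDiff ℝ 1 (fun y => (1 - χ y) * f y) := hχ'.mul hf
    have c1 : HasCompactSupport (fun y => χ y * f y) := hfc.mul_left
    have c2 : HasCompactSupport (fun y => (1 - χ y) * f y) := hfc.mul_left
    have i1 : ∫ x in M, divergence (fun y => (χ y * f y) • G y) x = 0 := by
      refine hasZeroFlux_compl_singularBoundary hM hW hMW hG ht _ e1 c1 fun x hx hxS => ?_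
      have hxf : x ∈ tsupport f := tsupport_mul_subset_right (f := χ) hx
      have hxb := hcov ⟨hxS, hxf⟩
      refine notMem_tsupport_iff_eventuallyEq.2 ?_ hx
      filter_upwards [(isOpen_biUnion fun i _ => isOpen_ball).mem_nhds hxb] with y hy
      simp [hχ0 y hy]
    have hsplit : ∀ x ∈ M, divergence (fun y => f y • G y) x =
        divergence (fun y => (χ y * f y) • G y) x +
          ((1 - χ x) * divergence (fun y => f y • G y) x - fderiv ℝ χ x (f x • G x)) := by
      intro x hx
      have := divergence_smul (hχ.differentiable one_ne_zero x) (hFd x hx)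
      simp only [smul_smul] at this
      rw [this]
      ring
    have hi1 := integrableOn_divergence_smul hM hW hMW hG e1 c1
    have hi0 := integrableOn_divergence_smul hM hW hMW hG hf hfc
    have hi2 : IntegrableOn (fun x => (1 - χ x) * divergence (fun y => f y • G y) x
        - fderiv ℝ χ x (f x • G x)) M := by
      refine (hi0.sub hi1).congr_fun (fun x hx => ?_) hM.measurableSet
      simp only [Pi.sub_apply]
      linarith [hsplit x hx]
    rw [setIntegral_congr_fun hM.measurableSet hsplit, integral_add hi1 hi2, i1, zero_add]
    have hind : ∀ i ∈ s, Integrable ((closedBall (c i) (2 * r i)).indicator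
        fun _ => (A + C * A') / r i) := fun i hi =>
      (integrableOn_const (isCompact_closedBall _ _).measure_lt_top.ne).integrable_indicator
        measurableSet_closedBall
    have hpt : ∀ x ∈ M, ‖(1 - χ x) * divergence (fun y => f y • G y) x
        - fderiv ℝ χ x (f x • G x)‖ ≤
        ∑ i ∈ s, (closedBall (c i) (2 * r i)).indicator (fun _ => (A + C * A') / r i) x := by
      intro x hx
      have h1 : ‖(1 - χ x) * divergence (fun y => f y • G y) x‖ ≤
          ∑ i ∈ s, (closedBall (c i) (2 * r i)).indicator (fun _ => 1) x * A := by
        rw [norm_mul, Real.norm_of_nonneg (by linarith [(hχ01 x).2]), ← Finset.sum_mul]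
        exact mul_le_mul (hχ1 x) (hA x hx) (norm_nonneg _)
          (Finset.sum_nonneg fun i _ => indicator_nonneg (fun _ _ => zero_le_one) _)
      have h2 : ‖fderiv ℝ χ x (f x • G x)‖ ≤
          ∑ i ∈ s, (closedBall (c i) (2 * r i)).indicator (fun _ => C / r i) x * A' := by
        rw [← Finset.sum_mul]
        refine (ContinuousLinearMap.le_opNorm _ _).trans
          (mul_le_mul (hχd x) (hA' x hx) (norm_nonneg _) ?_)
        exact (norm_nonneg _).trans (hχd x)
      refine (norm_sub_le _ _).trans ((add_le_add h1 h2).trans ?_)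
      rw [← Finset.sum_add_distrib]
      refine Finset.sum_le_sum fun i hi => ?_
      by_cases hxi : x ∈ closedBall (c i) (2 * r i)
      · simp only [indicator_of_mem hxi, one_mul]
        have hri := hr i hi
        have : A ≤ A / r i := by
          rw [le_div_iff₀ hri.1]
          exact mul_le_of_le_one_right hA0 hri.2
        calc A + C / r i * A' ≤ A / r i + C / r i * A' := by gcongr
          _ = (A + C * A') / r i := by ring
      · simp [indicator_of_notMem hxi]
    have hgi : Integrable (fun x => ∑ i ∈ s,
        (closedBall (c i) (2 * r i)).indicator (fun _ => (A + C * A') / r i) x) :=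
      integrable_finsetSum _ hind
    calc ‖∫ x in M, ((1 - χ x) * divergence (fun y => f y • G y) x
          - fderiv ℝ χ x (f x • G x))‖
        ≤ ∫ x in M, ∑ i ∈ s,
            (closedBall (c i) (2 * r i)).indicator (fun _ => (A + C * A') / r i) x :=
          norm_integral_le_of_norm_le hgi.integrableOn
            ((ae_restrict_iff' hM.measurableSet).2 (Eventually.of_forall hpt))
      _ ≤ ∫ x, ∑ i ∈ s,
            (closedBall (c i) (2 * r i)).indicator (fun _ => (A + C * A') / r i) x := by
          refine setIntegral_le_integral hgi (Eventually.of_forall fun x => ?_)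
          refine Finset.sum_nonneg fun i hi => indicator_nonneg (fun _ _ => ?_) _
          have := (hr i hi).1
          positivity
      _ = ∑ i ∈ s, (A + C * A') * κ * r i ^ 2 := by
          rw [integral_finsetSum _ hind]
          refine Finset.sum_congr rfl fun i hi => ?_
          have hri := (hr i hi).1
          rw [integral_indicator measurableSet_closedBall, setIntegral_const, smul_eq_mul,
            Measure.real, Measure.addHaar_closedBall' _ _ (by positivity), ENNReal.toReal_mul,
            ENNReal.toReal_ofReal (by positivity), finrank_euclideanSpace, hκ, Measure.real]
          simp only [Fintype.card_fin]
          field_simp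
          ring
      _ ≤ (A + C * A') * κ * ε := by
          rw [← Finset.mul_sum]
          exact mul_le_mul_of_nonneg_left hsum (by positivity)
  rw [← norm_le_zero_iff]
  refine le_of_forall_pos_le_add fun δ hδ => ?_
  rw [zero_add]
  set D := (A + C * A') * κ
  have hD : 0 ≤ D := by positivity
  refine (key (δ / (D + 1)) (by positivity)).trans ?_
  rw [mul_div_assoc', div_le_iff₀ (by positivity)]
  nlinarith

end DivergenceTheorem

/-! ### Conservation laws -/

section Conservation

variable {X : Type*} [NormedAddCommGroup X] [NormedSpace ℝ X]

lemma hasDerivAt_time {F : ℝ → E3 → X} {t : ℝ} {x : E3}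
    (hF : DifferentiableAt ℝ (fun p : ℝ × E3 => F p.1 p.2) (t, x)) :
    HasDerivAt (fun s => F s x) (fderiv ℝ (fun p : ℝ × E3 => F p.1 p.2) (t, x) (1, 0)) t :=
  HasFDerivAt.comp_hasDerivAt (f := fun s : ℝ => (s, x)) t hF.hasFDerivAt
    ((hasDerivAt_id t).prodMk (hasDerivAt_const t x))

lemma hasFDerivAt_space {F : ℝ → E3 → X} {t : ℝ} {x : E3}
    (hF : DifferentiableAt ℝ (fun p : ℝ × E3 => F p.1 p.2) (t, x)) :
    HasFDerivAt (F t) ((fderiv ℝ (fun p : ℝ × E3 => F p.1 p.2) (t, x)).comp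
      (ContinuousLinearMap.inr ℝ ℝ E3)) x :=
  HasFDerivAt.comp (f := fun y : E3 => (t, y)) x hF.hasFDerivAt (hasFDerivAt_prodMk_right t x)

lemma isOpen_slice {Ω : Set (ℝ × E3)} (hΩ : IsOpen Ω) (t : ℝ) : IsOpen {x | (t, x) ∈ Ω} :=
  hΩ.preimage (Continuous.prodMk_right t)

lemma contDiffOn_slice {Ω : Set (ℝ × E3)} {F : ℝ → E3 → X} {n : WithTop ℕ∞}
    (hF : ContDiffOn ℝ n (fun p : ℝ × E3 => F p.1 p.2) Ω) (t : ℝ) :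
    ContDiffOn ℝ n (F t) {x | (t, x) ∈ Ω} :=
  hF.comp (f := fun y : E3 => (t, y)) (contDiff_prodMk_right t).contDiffOn fun _ hx => hx

variable {I : Set ℝ} {M : Set E3} {Ω : Set (ℝ × E3)}

lemma integrableOn_spacetime_of_zero {h : ℝ × E3 → ℝ} (hΩI : I ×ˢ closure M ⊆ Ω)
    (hM : IsOpen M) (hh : ContinuousOn h Ω) {K : Set E3} (hK : IsCompact K)
    (h0 : ∀ t, ∀ x ∉ K, h (t, x) = 0) {s t : ℝ} (hst : Icc s t ⊆ I) :
    IntegrableOn h (Icc s t ×ˢ M) := by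
  have hc : IsCompact (Icc s t ×ˢ (K ∩ closure M)) :=
    isCompact_Icc.prod (hK.inter_right isClosed_closure)
  have : IntegrableOn h (Icc s t ×ˢ (K ∩ closure M)) :=
    (hh.mono ((prod_mono hst inter_subset_right).trans hΩI)).integrableOn_compact hc
  refine this.of_forall_sdiff_eq_zero (measurableSet_Icc.prod hM.measurableSet) ?_
  rintro ⟨τ, x⟩ ⟨⟨hτ, hx⟩, hn⟩
  exact h0 τ x fun hxK => hn ⟨hτ, hxK, subset_closure hx⟩

variable {γ : ℝ → E3 → ℝ} {u : ℝ → E3 → E3}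

/-- A conservation law, tested with a compactly supported function. -/
lemma integral_mul_sub_eq_flux (hM : IsOpen M) (hbdry : HasAESmoothBoundary M) (hΩ : IsOpen Ω)
    (hΩI : I ×ˢ closure M ⊆ Ω) (hγ : ContDiffOn ℝ 1 (fun p : ℝ × E3 => γ p.1 p.2) Ω)
    (hu : ContDiffOn ℝ 1 (fun p : ℝ × E3 => u p.1 p.2) Ω) (ht : ∀ t ∈ I, IsTangent M (u t))
    (hcl : ∀ t ∈ I, ∀ x ∈ M,
      deriv (fun s => γ s x) t = - divergence (fun y => γ t y • u t y) x)
    {f : E3 → ℝ} (hf : ContDiff ℝ 1 f) (hfc : HasCompactSupport f)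
    {s t : ℝ} (hle : s ≤ t) (hst : Icc s t ⊆ I) :
    ∫ x in M, (f x * γ t x - f x * γ s x) =
      ∫ p in Icc s t ×ˢ M, fderiv ℝ f p.2 (γ p.1 p.2 • u p.1 p.2) := by
  have hmem : ∀ τ ∈ Icc s t, ∀ x ∈ closure M, (τ, x) ∈ Ω := fun τ hτ x hx => hΩI ⟨hst hτ, hx⟩
  set Γ : ℝ × E3 → ℝ := fun p => γ p.1 p.2 with hΓ
  have hd : ∀ p ∈ Ω, DifferentiableAt ℝ Γ p := fun p hp =>
    (hγ.contDiffAt (hΩ.mem_nhds hp)).differentiableAt one_ne_zero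
  have hdc : ContinuousOn (fun p => fderiv ℝ Γ p (1, 0)) Ω :=
    (hγ.continuousOn_fderiv_of_isOpen hΩ le_rfl).clm_apply continuousOn_const
  have hYc : ContinuousOn (fun p : ℝ × E3 => f p.2 * fderiv ℝ Γ p (1, 0)) Ω :=
    (hf.continuous.comp continuous_snd).continuousOn.mul hdc
  have hXc : ContinuousOn (fun p : ℝ × E3 => fderiv ℝ f p.2 (γ p.1 p.2 • u p.1 p.2)) Ω :=
    ((hf.continuous_fderiv one_ne_zero).comp continuous_snd).continuousOn.clm_apply
      (hγ.continuousOn.smul hu.continuousOn)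
  have hYi := integrableOn_spacetime_of_zero hΩI hM hYc hfc
    (fun τ x hx => by simp [image_eq_zero_of_notMem_tsupport hx]) hst
  have hXi := integrableOn_spacetime_of_zero hΩI hM hXc hfc
    (fun τ x hx => by simp [fderiv_of_notMem_tsupport ℝ hx]) hst
  have h1 : ∀ x ∈ M, f x * γ t x - f x * γ s x =
      ∫ τ in Icc s t, f x * fderiv ℝ Γ (τ, x) (1, 0) := fun x hx => by
    have hder : ∀ τ ∈ uIcc s t, HasDerivAt (fun τ => f x * γ τ x)
        (f x * fderiv ℝ Γ (τ, x) (1, 0)) τ := fun τ hτ => by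
      rw [uIcc_of_le hle] at hτ
      exact (hasDerivAt_time (hd _ (hmem τ hτ x (subset_closure hx)))).const_mul _
    have hcont : ContinuousOn (fun τ => f x * fderiv ℝ Γ (τ, x) (1, 0)) (uIcc s t) := by
      rw [uIcc_of_le hle]
      exact hYc.comp (f := fun τ : ℝ => (τ, x)) (by fun_prop)
        fun τ hτ => hmem τ hτ x (subset_closure hx)
    rw [← intervalIntegral.integral_eq_sub_of_hasDerivAt hder hcont.intervalIntegrable,
      intervalIntegral.integral_of_le hle, integral_Icc_eq_integral_Ioc]
  have h2 : ∀ τ ∈ Icc s t, ∫ x in M, f x * fderiv ℝ Γ (τ, x) (1, 0) =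
      ∫ x in M, fderiv ℝ f x (γ τ x • u τ x) := fun τ hτ => by
    have hW := isOpen_slice hΩ τ
    have hMW : closure M ⊆ {x | (τ, x) ∈ Ω} := fun x hx => hmem τ hτ x hx
    have hγs := contDiffOn_slice hγ τ
    have hus := contDiffOn_slice hu τ
    have hG : ContDiffOn ℝ 1 (fun y => γ τ y • u τ y) {x | (τ, x) ∈ Ω} := hγs.smul hus
    have htan : IsTangent M (fun y => γ τ y • u τ y) := fun x n hn => by
      rw [real_inner_smul_right, ht τ (hst hτ) x n hn, mul_zero]
    have hX1 : IntegrableOn (fun x => fderiv ℝ f x (γ τ x • u τ x)) M :=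
      integrableOn_of_continuousOn_of_zero hM hMW hfc
        ((hf.continuous_fderiv one_ne_zero).continuousOn.clm_apply hG.continuousOn)
        fun x hx => by simp [fderiv_of_notMem_tsupport ℝ hx]
    have hD := integrableOn_divergence_smul hM hW hMW hG hf hfc
    have hpt : ∀ x ∈ M, f x * fderiv ℝ Γ (τ, x) (1, 0) =
        fderiv ℝ f x (γ τ x • u τ x) - divergence (fun y => f y • (γ τ y • u τ y)) x :=
      fun x hx => by
        have hxW := hMW (subset_closure hx)
        rw [divergence_smul (hf.differentiable one_ne_zero x)
          ((hG.contDiffAt (hW.mem_nhds hxW)).differentiableAt one_ne_zero),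
          ← (hasDerivAt_time (hd _ hxW)).deriv, hcl τ (hst hτ) x hx]
        ring
    rw [setIntegral_congr_fun hM.measurableSet hpt, integral_sub hX1 hD,
      setIntegral_divergence_smul_eq_zero hM hbdry hW hMW hG htan hf hfc, sub_zero]
  rw [setIntegral_congr_fun hM.measurableSet h1]
  rw [Measure.volume_eq_prod] at hXi hYi ⊢
  rw [setIntegral_prod _ hXi, ← setIntegral_congr_fun measurableSet_Icc h2]
  have hYi' : Integrable (fun p : ℝ × E3 => f p.2 * fderiv ℝ Γ p (1, 0))
      ((volume.restrict (Icc s t)).prod (volume.restrict M)) := by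
    rwa [Measure.prod_restrict]
  exact (integral_integral_swap (f := fun τ x => f x * fderiv ℝ Γ (τ, x) (1, 0)) hYi').symm

/-- A density which is transported by a field tangent to the boundary has a conserved integral. -/
theorem integral_eq_of_continuity_equation (hI : I.OrdConnected) (hM : IsOpen M)
    (hbdry : HasAESmoothBoundary M) (hΩ : IsOpen Ω)
    (hΩI : I ×ˢ closure M ⊆ Ω) (hγ : ContDiffOn ℝ 1 (fun p : ℝ × E3 => γ p.1 p.2) Ω)
    (hu : ContDiffOn ℝ 1 (fun p : ℝ × E3 => u p.1 p.2) Ω) (ht : ∀ t ∈ I, IsTangent M (u t))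
    (hcl : ∀ t ∈ I, ∀ x ∈ M,
      deriv (fun s => γ s x) t = - divergence (fun y => γ t y • u t y) x)
    (hint : ∀ t ∈ I, IntegrableOn (γ t) M)
    (hflux : ∀ s ∈ I, ∀ t ∈ I,
      IntegrableOn (fun p : ℝ × E3 => γ p.1 p.2 • u p.1 p.2) (Icc s t ×ˢ M))
    {s t : ℝ} (hs : s ∈ I) (ht' : t ∈ I) :
    ∫ x in M, γ s x = ∫ x in M, γ t x := by
  wlog hle : s ≤ t generalizing s t with hwlog
  · exact (hwlog ht' hs (le_of_not_ge hle)).symm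
  have hst : Icc s t ⊆ I := hI.out hs ht'
  obtain ⟨C, hC, hbump⟩ := exists_bump
  choose! η hη hη01 hη1 hη0 hηd using hbump
  let f : ℕ → E3 → ℝ := fun n => η 0 ((n : ℝ) + 1)
  have hn : ∀ n : ℕ, (0 : ℝ) < (n : ℝ) + 1 := fun n => by positivity
  have hfc : ∀ n, HasCompactSupport (f n) := fun n =>
    HasCompactSupport.intro (isCompact_closedBall 0 _) (hη0 0 _ (hn n))
  have hmain := fun n => integral_mul_sub_eq_flux hM hbdry hΩ hΩI hγ hu ht hcl
    (hη 0 _ (hn n)) (hfc n) hle hst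
  have hγi : IntegrableOn (fun x => γ t x - γ s x) M := (hint t ht').sub (hint s hs)
  have hlim1 : Tendsto (fun n => ∫ x in M, (f n x * γ t x - f n x * γ s x)) atTop
      (𝓝 (∫ x in M, (γ t x - γ s x))) := by
    refine tendsto_integral_of_dominated_convergence (fun x => ‖γ t x - γ s x‖) (fun n => ?_)
      hγi.norm (fun n => Eventually.of_forall fun x => ?_) (Eventually.of_forall fun x => ?_)
    · simp only [← mul_sub]
      exact (hη 0 _ (hn n)).continuous.aestronglyMeasurable.mul hγi.aestronglyMeasurable
    · rw [← mul_sub, norm_mul, Real.norm_of_nonneg (hη01 0 _ (hn n) x).1]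
      exact mul_le_of_le_one_left (norm_nonneg _) (hη01 0 _ (hn n) x).2
    · refine tendsto_const_nhds.congr' ?_
      obtain ⟨N, hN⟩ := exists_nat_gt ‖x‖
      filter_upwards [eventually_ge_atTop N] with n hnN
      have hnN' : (N : ℝ) ≤ n := by exact_mod_cast hnN
      have : f n x = 1 := hη1 0 _ (hn n) x (by rw [mem_ball_zero_iff]; linarith)
      rw [this, one_mul, one_mul]
  have hlim2 : Tendsto (fun n => ∫ x in M, (f n x * γ t x - f n x * γ s x)) atTop (𝓝 0) := by
    set A := ∫ p in Icc s t ×ˢ M, ‖γ p.1 p.2 • u p.1 p.2‖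
    have hz : Tendsto (fun n : ℕ => C * A * (1 / ((n : ℝ) + 1))) atTop (𝓝 0) := by
      simpa using tendsto_one_div_add_atTop_nhds_zero_nat.const_mul (C * A)
    refine squeeze_zero_norm (fun n => ?_) hz
    rw [hmain n]
    have hfl := hflux s hs t ht'
    refine (norm_integral_le_of_norm_le (hfl.norm.const_mul (C / ((n : ℝ) + 1)))
      (Eventually.of_forall fun p => ?_)).trans (le_of_eq ?_)
    · refine (ContinuousLinearMap.le_opNorm _ _).trans
        (mul_le_mul_of_nonneg_right ?_ (norm_nonneg _))
      refine (hηd 0 _ (hn n) p.2).trans (indicator_le_self' (fun _ _ => ?_) _)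
      have := hn n
      positivity
    · rw [integral_const_mul]
      ring
  have := tendsto_nhds_unique hlim1 hlim2
  rw [integral_sub (hint t ht') (hint s hs)] at this
  linarith

lemma integrable_of_isBounded (hΩI : I ×ˢ closure M ⊆ Ω)
    (hI : I.OrdConnected) (hMb : Bornology.IsBounded M)
    (hγ : ContinuousOn (fun p : ℝ × E3 => γ p.1 p.2) Ω)
    (hu : ContinuousOn (fun p : ℝ × E3 => u p.1 p.2) Ω) :
    (∀ t ∈ I, IntegrableOn (γ t) M) ∧ ∀ s ∈ I, ∀ t ∈ I,
      IntegrableOn (fun p : ℝ × E3 => γ p.1 p.2 • u p.1 p.2) (Icc s t ×ˢ M) := by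
  have hc : IsCompact (closure M) := hMb.isCompact_closure
  refine ⟨fun t ht => ?_, fun s hs t ht => ?_⟩
  · have : ContinuousOn (γ t) (closure M) :=
      hγ.comp (f := fun x : E3 => (t, x)) (by fun_prop) fun x hx => hΩI ⟨ht, hx⟩
    exact (this.integrableOn_compact hc).mono_set subset_closure
  · have : ContinuousOn (fun p : ℝ × E3 => γ p.1 p.2 • u p.1 p.2) (Icc s t ×ˢ closure M) :=
      (hγ.smul hu).mono ((prod_mono (hI.out hs ht) subset_rfl).trans hΩI)
    exact (this.integrableOn_compact (isCompact_Icc.prod hc)).mono_set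
      (prod_mono subset_rfl subset_closure)

end Conservation

/-! ### Vector identities -/

lemma cross_coord (a b : E3) : cross a b 0 = a 1 * b 2 - a 2 * b 1 ∧
    cross a b 1 = a 2 * b 0 - a 0 * b 2 ∧ cross a b 2 = a 0 * b 1 - a 1 * b 0 := by
  simp [cross, cross_apply]

lemma partialD_cross {F G : E3 → E3} {x : E3} (hF : DifferentiableAt ℝ F x)
    (hG : DifferentiableAt ℝ G x) (i : Fin 3) :
    (fun j => partialD i (fun y => cross (F y) (G y)) j x) =
      (cross (fderiv ℝ F x (EuclideanSpace.single i 1)) (G x) +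
        cross (F x) (fderiv ℝ G x (EuclideanSpace.single i 1))).ofLp := by
  let L : E3 →L[ℝ] E3 →L[ℝ] E3 := LinearMap.toContinuousBilinearMap
    (LinearMap.mk₂ ℝ cross (fun a b c => by simp [cross]) (fun r a b => by simp [cross])
      (fun a b c => by simp [cross]) (fun r a b => by simp [cross]))
  have h : fderiv ℝ (fun y => cross (F y) (G y)) x = _ :=
    L.fderiv_of_bilinear hF hG
  ext j
  simp only [partialD, h]
  simp only [ContinuousLinearMap.precompR_apply, ContinuousLinearMap.precompL_apply, add_apply,
    PiLp.add_apply]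
  exact add_comm _ _

lemma curl_cross {F G : E3 → E3} {x : E3} (hF : DifferentiableAt ℝ F x)
    (hG : DifferentiableAt ℝ G x) :
    curl (fun y => cross (F y) (G y)) x = fderiv ℝ F x (G x) - fderiv ℝ G x (F x)
      + divergence G x • F x - divergence F x • G x := by
  have h := fun i j => congrFun (partialD_cross hF hG i) j
  simp only [PiLp.add_apply] at h
  rw [fderiv_apply_eq_sum (fderiv ℝ F x), fderiv_apply_eq_sum (fderiv ℝ G x)]
  have hF' : ∀ i j, partialD i F j x = fderiv ℝ F x (EuclideanSpace.single i 1) j :=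
    fun _ _ => rfl
  have hG' : ∀ i j, partialD i G j x = fderiv ℝ G x (EuclideanSpace.single i 1) j :=
    fun _ _ => rfl
  ext k
  fin_cases k <;>
  · simp [curl, h, divergence, Fin.sum_univ_three, cross_coord, hF', hG']
    ring

lemma inner_eq_sum (a b : E3) : inner ℝ a b = a 0 * b 0 + a 1 * b 1 + a 2 * b 2 := by
  simp [PiLp.inner_apply, Fin.sum_univ_three]
  ring

lemma inner_cross_curl (F : E3 → E3) (x a w : E3) :
    inner ℝ (cross a (curl F x)) w =
      inner ℝ (fderiv ℝ F x w) a - inner ℝ (fderiv ℝ F x a) w := by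
  rw [fderiv_apply_eq_sum (fderiv ℝ F x) w, fderiv_apply_eq_sum (fderiv ℝ F x) a]
  simp [inner_eq_sum, curl, partialD, Fin.sum_univ_three, cross_coord]
  ring

/-! ### Second derivatives -/

section Second

variable {E F : Type*} [NormedAddCommGroup E] [NormedSpace ℝ E] [NormedAddCommGroup F]
  [NormedSpace ℝ F]

lemma differentiableAt_fderiv {f : E → F} {p : E} (hf : ContDiffAt ℝ 2 f p) :
    DifferentiableAt ℝ (fderiv ℝ f) p :=
  (hf.fderiv_right (m := 1) (by norm_num)).differentiableAt one_ne_zero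

lemma fderiv_fderiv_comm {f : E → F} {p : E} (hf : ContDiffAt ℝ 2 f p) (a b : E) :
    fderiv ℝ (fderiv ℝ f) p a b = fderiv ℝ (fderiv ℝ f) p b a :=
  hf.isSymmSndFDerivAt (by simp) a b

lemma fderiv_fderiv_apply {f : E → F} {w : E → E} {p : E} (hf : ContDiffAt ℝ 2 f p)
    {w' : E →L[ℝ] E} (hw : HasFDerivAt w w' p) (d : E) :
    fderiv ℝ (fun q => fderiv ℝ f q (w q)) p d =
      fderiv ℝ f p (w' d) + fderiv ℝ (fderiv ℝ f) p d (w p) := by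
  rw [((differentiableAt_fderiv hf).hasFDerivAt.clm_apply hw).fderiv]
  rfl

lemma differentiableAt_fderiv_apply {f : E → F} {w : E → E} {p : E} (hf : ContDiffAt ℝ 2 f p)
    (hw : DifferentiableAt ℝ w p) : DifferentiableAt ℝ (fun q => fderiv ℝ f q (w q)) p :=
  (differentiableAt_fderiv hf).clm_apply hw

end Second

lemma gradient_coord (f : E3 → ℝ) (x : E3) (i : Fin 3) :
    gradient f x i = fderiv ℝ f x (EuclideanSpace.single i 1) := by
  rw [← inner_gradient_left, EuclideanSpace.inner_single_right]
  simp

lemma contDiffAt_gradient {f : E3 → ℝ} {x : E3} (hf : ContDiffAt ℝ 2 f x) :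
    ContDiffAt ℝ 1 (gradient f) x :=
  (InnerProductSpace.toDual ℝ E3).symm.contDiff.contDiffAt.comp x
    (hf.fderiv_right (m := 1) (by norm_num))

lemma differentiableAt_gradient {f : E3 → ℝ} {x : E3} (hf : ContDiffAt ℝ 2 f x) :
    DifferentiableAt ℝ (gradient f) x :=
  (contDiffAt_gradient hf).differentiableAt one_ne_zero

lemma partialD_gradient_comm {f : E3 → ℝ} {x : E3} (hf : ContDiffAt ℝ 2 f x) (i j : Fin 3) :
    partialD i (gradient f) j x = partialD j (gradient f) i x := by
  have h : ∀ i j : Fin 3, partialD i (gradient f) j x = fderiv ℝ (fderiv ℝ f) x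
      (EuclideanSpace.single i 1) (EuclideanSpace.single j 1) := fun i j => by
    rw [partialD_eq (differentiableAt_gradient hf)]
    simp only [gradient_coord]
    rw [fderiv_fderiv_apply hf (hasFDerivAt_const _ x)]
    simp
  rw [h, h, fderiv_fderiv_comm hf]

lemma curl_add_gradient {F : E3 → E3} {f : E3 → ℝ} {x : E3} (hF : DifferentiableAt ℝ F x)
    (hf : ContDiffAt ℝ 2 f x) : curl (fun y => F y + gradient f y) x = curl F x := by
  have h : ∀ i j, partialD i (fun y => F y + gradient f y) j x =
      partialD i F j x + partialD i (gradient f) j x := fun i j => by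
    simp only [partialD, fderiv_fun_add hF (differentiableAt_gradient hf)]
    simp
  simp only [curl, h]
  rw [partialD_gradient_comm hf 1 2, partialD_gradient_comm hf 2 0, partialD_gradient_comm hf 0 1]
  simp

lemma divergence_curl {F : E3 → E3} {x : E3} (hF : ContDiffAt ℝ 2 F x) :
    divergence (curl F) x = 0 := by
  have hd : ∀ i j : Fin 3, DifferentiableAt ℝ (partialD i F j) x := fun i j =>
    (EuclideanSpace.proj j : E3 →L[ℝ] ℝ).differentiableAt.comp x
      (differentiableAt_fderiv_apply hF (differentiableAt_const _))
  have h2 : ∀ i j k : Fin 3, fderiv ℝ (partialD i F j) x (EuclideanSpace.single k 1) =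
      fderiv ℝ (fderiv ℝ F) x (EuclideanSpace.single k 1) (EuclideanSpace.single i 1) j := by
    intro i j k
    have h := ((EuclideanSpace.proj j : E3 →L[ℝ] ℝ).hasFDerivAt.comp x
      (differentiableAt_fderiv_apply (w := fun _ => EuclideanSpace.single i (1 : ℝ)) hF
        (differentiableAt_const _)).hasFDerivAt).fderiv
    have h3 := fderiv_fderiv_apply hF (hasFDerivAt_const (EuclideanSpace.single i (1 : ℝ)) x)
      (EuclideanSpace.single k 1)
    rw [show partialD i F j = (EuclideanSpace.proj j : E3 →L[ℝ] ℝ) ∘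
      fun q => fderiv ℝ F q (EuclideanSpace.single i 1) from rfl, h,
      ContinuousLinearMap.comp_apply, h3]
    simp
  have hcurl : DifferentiableAt ℝ (curl F) x := by
    rw [differentiableAt_euclidean]
    intro i
    fin_cases i
    · exact (hd 1 2).sub (hd 2 1)
    · exact (hd 2 0).sub (hd 0 2)
    · exact (hd 0 1).sub (hd 1 0)
  simp only [divergence, Fin.sum_univ_three, partialD_eq hcurl]
  have e0 : (fun y => curl F y 0) = fun y => partialD 1 F 2 y - partialD 2 F 1 y := rfl
  have e1 : (fun y => curl F y 1) = fun y => partialD 2 F 0 y - partialD 0 F 2 y := rfl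
  have e2 : (fun y => curl F y 2) = fun y => partialD 0 F 1 y - partialD 1 F 0 y := rfl
  rw [e0, e1, e2, fderiv_fun_sub (hd _ _) (hd _ _), fderiv_fun_sub (hd _ _) (hd _ _),
    fderiv_fun_sub (hd _ _) (hd _ _)]
  simp only [sub_apply, h2]
  rw [fderiv_fderiv_comm hF (EuclideanSpace.single 0 1) (EuclideanSpace.single 1 1),
    fderiv_fderiv_comm hF (EuclideanSpace.single 0 1) (EuclideanSpace.single 2 1),
    fderiv_fderiv_comm hF (EuclideanSpace.single 1 1) (EuclideanSpace.single 2 1)]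
  ring

/-! ### Material derivatives -/

section Material

variable {X : Type*} [NormedAddCommGroup X] [NormedSpace ℝ X]

/-- The material derivative `∂_t + L_u`. -/
noncomputable def materialD (u : ℝ → E3 → E3) (F : ℝ → E3 → X) (t : ℝ) (x : E3) : X :=
  fderiv ℝ (fun p : ℝ × E3 => F p.1 p.2) (t, x) (1, u t x)

variable {u : ℝ → E3 → E3} {F : ℝ → E3 → X} {t : ℝ} {x : E3}

lemma fderiv_slice (hF : DifferentiableAt ℝ (fun p : ℝ × E3 => F p.1 p.2) (t, x)) (w : E3) :
    fderiv ℝ (F t) x w = fderiv ℝ (fun p : ℝ × E3 => F p.1 p.2) (t, x) (0, w) := by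
  rw [(hasFDerivAt_space hF).fderiv]
  simp

lemma differentiableAt_slice (hF : DifferentiableAt ℝ (fun p : ℝ × E3 => F p.1 p.2) (t, x)) :
    DifferentiableAt ℝ (F t) x := (hasFDerivAt_space hF).differentiableAt

lemma contDiffAt_slice {n : WithTop ℕ∞}
    (hF : ContDiffAt ℝ n (fun p : ℝ × E3 => F p.1 p.2) (t, x)) : ContDiffAt ℝ n (F t) x :=
  ContDiffAt.comp (f := fun y : E3 => (t, y)) x hF (contDiff_prodMk_right t).contDiffAt

lemma materialD_eq (hF : DifferentiableAt ℝ (fun p : ℝ × E3 => F p.1 p.2) (t, x)) :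
    materialD u F t x = deriv (fun s => F s x) t + fderiv ℝ (F t) x (u t x) := by
  rw [(hasDerivAt_time hF).deriv, fderiv_slice hF, ← map_add, materialD]
  simp

/-- The spatial derivative of a function that vanishes on a time slice. -/
lemma fderiv_space_eq_zero {M : Set E3} (hM : IsOpen M) (hx : x ∈ M) {h : ℝ × E3 → X}
    (hd : DifferentiableAt ℝ h (t, x)) (h0 : ∀ y ∈ M, h (t, y) = 0) (w : E3) :
    fderiv ℝ h (t, x) (0, w) = 0 := by
  have h1 := fderiv_slice (F := fun t y => h (t, y)) hd w
  have h2 : (fun y => h (t, y)) =ᶠ[𝓝 x] fun _ => 0 := by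
    filter_upwards [hM.mem_nhds hx] with y hy using h0 y hy
  rw [h2.fderiv_eq] at h1
  simpa using h1.symm

lemma hasFDerivAt_one_prodMk (hu : DifferentiableAt ℝ (fun p : ℝ × E3 => u p.1 p.2) (t, x)) :
    HasFDerivAt (fun p : ℝ × E3 => ((1 : ℝ), u p.1 p.2))
      ((0 : ℝ × E3 →L[ℝ] ℝ).prod (fderiv ℝ (fun p : ℝ × E3 => u p.1 p.2) (t, x))) (t, x) :=
  (hasFDerivAt_const (1 : ℝ) (t, x)).prodMk hu.hasFDerivAt

lemma hasFDerivAt_zero_prodMk (hu : DifferentiableAt ℝ (fun p : ℝ × E3 => u p.1 p.2) (t, x)) :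
    HasFDerivAt (fun p : ℝ × E3 => ((0 : ℝ), u p.1 p.2))
      ((0 : ℝ × E3 →L[ℝ] ℝ).prod (fderiv ℝ (fun p : ℝ × E3 => u p.1 p.2) (t, x))) (t, x) :=
  (hasFDerivAt_const (0 : ℝ) (t, x)).prodMk hu.hasFDerivAt

/-- The Lie derivative along a frozen-in field preserves transported functions. -/
lemma materialD_lieD_eq_zero {M : Set E3} (hM : IsOpen M) (hx : x ∈ M) {v : ℝ → E3 → E3}
    {f : ℝ → E3 → ℝ} (hf : ContDiffAt ℝ 2 (fun p : ℝ × E3 => f p.1 p.2) (t, x))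
    (hu : DifferentiableAt ℝ (fun p : ℝ × E3 => u p.1 p.2) (t, x))
    (hv : DifferentiableAt ℝ (fun p : ℝ × E3 => v p.1 p.2) (t, x))
    (hvu : materialD u v t x = fderiv ℝ (u t) x (v t x))
    (h0 : ∀ y ∈ M, materialD u f t y = 0) :
    materialD u (fun t => lieD (v t) (f t)) t x = 0 := by
  have hev : (fun p : ℝ × E3 => lieD (v p.1) (f p.1) p.2) =ᶠ[𝓝 (t, x)]
      fun p => fderiv ℝ (fun p : ℝ × E3 => f p.1 p.2) p (0, v p.1 p.2) := by
    filter_upwards [hf.eventually (by simp)] with p hp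
    exact fderiv_slice (hp.differentiableAt two_ne_zero) _
  have h1 := fderiv_space_eq_zero hM hx (differentiableAt_fderiv_apply hf
    (hasFDerivAt_one_prodMk hu).differentiableAt) h0 (v t x)
  rw [fderiv_fderiv_apply hf (hasFDerivAt_one_prodMk hu)] at h1
  rw [materialD, hev.fderiv_eq, fderiv_fderiv_apply hf (hasFDerivAt_zero_prodMk hv)]
  rw [materialD, fderiv_slice hu] at hvu
  rw [fderiv_fderiv_comm hf]
  simpa [hvu] using h1

/-- The specific magnetic field is frozen in. -/
lemma materialD_specific_field {M : Set E3} (hM : IsOpen M) (hx : x ∈ M)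
    {ρ : ℝ → E3 → ℝ} {B v A₀ : ℝ → E3 → E3}
    (hu : DifferentiableAt ℝ (fun p : ℝ × E3 => u p.1 p.2) (t, x))
    (hρ : DifferentiableAt ℝ (fun p : ℝ × E3 => ρ p.1 p.2) (t, x))
    (hB : DifferentiableAt ℝ (fun p : ℝ × E3 => B p.1 p.2) (t, x))
    (hv : DifferentiableAt ℝ (fun p : ℝ × E3 => v p.1 p.2) (t, x))
    (hA : ContDiffAt ℝ 2 (fun p : ℝ × E3 => A₀ p.1 p.2) (t, x)) (hρ0 : ρ t x ≠ 0)
    (hBv : (fun p : ℝ × E3 => B p.1 p.2) =ᶠ[𝓝 (t, x)] fun p => ρ p.1 p.2 • v p.1 p.2)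
    (hBA : ∀ y ∈ M, B t y = curl (A₀ t) y)
    (hmass : deriv (fun s => ρ s x) t = - divergence (fun y => ρ t y • u t y) x)
    (hind : deriv (fun s => B s x) t = curl (fun y => cross (u t y) (B t y)) x) :
    materialD u v t x = fderiv ℝ (u t) x (v t x) := by
  have hus := differentiableAt_slice hu
  have hdivB : divergence (B t) x = 0 := by
    rw [divergence_congr (G := curl (A₀ t)) (by
      filter_upwards [hM.mem_nhds hx] with y hy using hBA y hy)]
    exact divergence_curl (contDiffAt_slice hA)
  have hBx : B t x = ρ t x • v t x := hBv.eq_of_nhds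
  have hDB : materialD u B t x = fderiv ℝ (u t) x (B t x) - divergence (u t) x • B t x := by
    rw [materialD_eq hB, hind, curl_cross hus (differentiableAt_slice hB), hdivB]
    module
  have hDρ : materialD u ρ t x = - (ρ t x * divergence (u t) x) := by
    rw [materialD_eq hρ, hmass, divergence_smul (differentiableAt_slice hρ) hus]
    ring
  have hprod : materialD u B t x = materialD u ρ t x • v t x + ρ t x • materialD u v t x := by
    have h : fderiv ℝ (fun p : ℝ × E3 => ρ p.1 p.2 • v p.1 p.2) (t, x) = _ :=
      fderiv_fun_smul hρ hv
    rw [materialD, hBv.fderiv_eq, h, materialD, materialD]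
    simp [add_comm]
  rw [hDB, hDρ, hBx, map_smul] at hprod
  refine smul_right_injective E3 hρ0 ?_
  calc ρ t x • materialD u v t x
      = (ρ t x • fderiv ℝ (u t) x (v t x) - divergence (u t) x • ρ t x • v t x)
        + divergence (u t) x • ρ t x • v t x := by
        rw [hprod]
        module
    _ = ρ t x • fderiv ℝ (u t) x (v t x) := sub_add_cancel _ _

/-- The gauge-transformed potential is transported as a one-form. -/
lemma inner_materialD_gaugeTransform {M : Set E3} (hM : IsOpen M) (hx : x ∈ M)
    {B A₀ : ℝ → E3 → E3} {ψ : ℝ → E3 → ℝ}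
    (hu : DifferentiableAt ℝ (fun p : ℝ × E3 => u p.1 p.2) (t, x))
    (hA : DifferentiableAt ℝ (fun p : ℝ × E3 => A₀ p.1 p.2) (t, x))
    (hψ : ContDiffAt ℝ 2 (fun p : ℝ × E3 => ψ p.1 p.2) (t, x))
    (hgr : DifferentiableAt ℝ (fun p : ℝ × E3 => gradient (ψ p.1) p.2) (t, x))
    (hψM : ∀ y ∈ M, DifferentiableAt ℝ (fun p : ℝ × E3 => ψ p.1 p.2) (t, y))
    (hBA : B t x = curl (A₀ t) x)
    (hE : electricField u B t x = - deriv (fun s => A₀ s x) t)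
    (htr : ∀ y ∈ M, deriv (fun s => ψ s y) t + lieD (u t) (ψ t) y
      + inner ℝ (u t y) (A₀ t y) = 0) (w : E3) :
    inner ℝ (materialD u (gaugeTransform A₀ ψ) t x) w =
      - inner ℝ (gaugeTransform A₀ ψ t x) (fderiv ℝ (u t) x w) := by
  have hDA₀ : inner ℝ (materialD u A₀ t x) w = inner ℝ (fderiv ℝ (A₀ t) x w) (u t x) := by
    have h1 : deriv (fun s => A₀ s x) t = cross (u t x) (curl (A₀ t) x) := by
      rw [← hBA, ← neg_inj, ← hE, electricField]
    rw [materialD_eq hA, h1, inner_add_left, inner_cross_curl]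
    ring
  have hψd : fderiv ℝ (fun p : ℝ × E3 => fderiv ℝ (fun p : ℝ × E3 => ψ p.1 p.2) p
      ((1 : ℝ), u p.1 p.2)) (t, x) (0, w) = _ :=
    fderiv_fderiv_apply hψ (hasFDerivAt_one_prodMk hu) (0, w)
  have hDψ : inner ℝ (materialD u (fun t => gradient (ψ t)) t x) w =
      fderiv ℝ (fderiv ℝ (fun p : ℝ × E3 => ψ p.1 p.2)) (t, x) (1, u t x) (0, w) := by
    have h1 : materialD u (fun t y => inner ℝ (gradient (ψ t) y) w) t x =
        inner ℝ (materialD u (fun t => gradient (ψ t)) t x) w := by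
      rw [materialD, fderiv_inner_apply ℝ hgr (differentiableAt_const _)]
      simp [materialD]
    have h2 : (fun p : ℝ × E3 => inner ℝ (gradient (ψ p.1) p.2) w) =ᶠ[𝓝 (t, x)]
        fun p => fderiv ℝ (fun p : ℝ × E3 => ψ p.1 p.2) p (0, w) := by
      filter_upwards [hψ.eventually (by simp)] with p hp
      rw [inner_gradient_left]
      exact fderiv_slice (hp.differentiableAt two_ne_zero) _
    rw [← h1, materialD, h2.fderiv_eq, fderiv_fderiv_apply hψ (hasFDerivAt_const _ _)]
    simp
  have htr' := fderiv_space_eq_zero hM hx (h := fun p : ℝ × E3 =>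
    fderiv ℝ (fun p : ℝ × E3 => ψ p.1 p.2) p ((1 : ℝ), u p.1 p.2)
      + inner ℝ (u p.1 p.2) (A₀ p.1 p.2))
    ((differentiableAt_fderiv_apply hψ (hasFDerivAt_one_prodMk hu).differentiableAt).add
      (hu.inner ℝ hA)) (fun y hy => by
        have h := materialD_eq (u := u) (hψM y hy)
        rw [materialD] at h
        rw [h]
        exact htr y hy) w
  rw [fderiv_fun_add (differentiableAt_fderiv_apply hψ (hasFDerivAt_one_prodMk hu).differentiableAt)
    (hu.inner ℝ hA), add_apply, hψd, fderiv_inner_apply ℝ hu hA, fderiv_fderiv_comm hψ,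
    ← hDψ, ← fderiv_slice hA, ← fderiv_slice hu] at htr'
  have hgψ : fderiv ℝ (fun p : ℝ × E3 => ψ p.1 p.2) (t, x)
      (((0 : ℝ × E3 →L[ℝ] ℝ).prod (fderiv ℝ (fun p : ℝ × E3 => u p.1 p.2) (t, x))) (0, w)) =
      inner ℝ (gradient (ψ t) x) (fderiv ℝ (u t) x w) := by
    rw [inner_gradient_left, fderiv_slice (hψM x hx), fderiv_slice hu]
    rfl
  rw [hgψ] at htr'
  have hsum : materialD u (gaugeTransform A₀ ψ) t x =
      materialD u A₀ t x + materialD u (fun t => gradient (ψ t)) t x := by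
    have h : fderiv ℝ (fun p : ℝ × E3 => A₀ p.1 p.2 + gradient (ψ p.1) p.2) (t, x) = _ :=
      fderiv_fun_add hA hgr
    simp only [materialD, gaugeTransform, h]
    rfl
  rw [hsum, inner_add_left, hDA₀, gaugeTransform, inner_add_left,
    real_inner_comm (fderiv ℝ (u t) x w) (A₀ t x), real_inner_comm (u t x)]
  linarith

/-- The specific helicity is transported. -/
lemma materialD_inner_eq_zero {v A : ℝ → E3 → E3}
    (hv : DifferentiableAt ℝ (fun p : ℝ × E3 => v p.1 p.2) (t, x))
    (hA : DifferentiableAt ℝ (fun p : ℝ × E3 => A p.1 p.2) (t, x))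
    (hvu : materialD u v t x = fderiv ℝ (u t) x (v t x))
    (hAu : ∀ w, inner ℝ (materialD u A t x) w = - inner ℝ (A t x) (fderiv ℝ (u t) x w)) :
    materialD u (fun t y => inner ℝ (v t y) (A t y)) t x = 0 := by
  have h : materialD u (fun t y => inner ℝ (v t y) (A t y)) t x =
      inner ℝ (v t x) (materialD u A t x) + inner ℝ (materialD u v t x) (A t x) := by
    rw [materialD, fderiv_inner_apply ℝ hv hA]
    rfl
  rw [h, hvu, real_inner_comm, hAu, real_inner_comm]
  ring

/-- The continuity equation for `ρ f` with `f` transported. -/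
lemma continuity_equation_mul {ρ f : ℝ → E3 → ℝ}
    (hu : DifferentiableAt ℝ (fun p : ℝ × E3 => u p.1 p.2) (t, x))
    (hρ : DifferentiableAt ℝ (fun p : ℝ × E3 => ρ p.1 p.2) (t, x))
    (hf : DifferentiableAt ℝ (fun p : ℝ × E3 => f p.1 p.2) (t, x))
    (hmass : deriv (fun s => ρ s x) t = - divergence (fun y => ρ t y • u t y) x)
    (h0 : materialD u f t x = 0) :
    deriv (fun s => ρ s x * f s x) t = - divergence (fun y => (ρ t y * f t y) • u t y) x := by
  have hρt := (hasDerivAt_time hρ).differentiableAt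
  have hft := (hasDerivAt_time hf).differentiableAt
  have hρu : DifferentiableAt ℝ (fun y => ρ t y • u t y) x :=
    (differentiableAt_slice hρ).smul (differentiableAt_slice hu)
  have h1 : (fun y => (ρ t y * f t y) • u t y) = fun y => f t y • (ρ t y • u t y) := by
    ext1 y
    rw [smul_smul, mul_comm]
  rw [materialD_eq hf] at h0
  rw [h1, divergence_smul (differentiableAt_slice hf) hρu, deriv_fun_mul hρt hft, hmass,
    map_smul, smul_eq_mul]
  linear_combination ρ t x * h0

end Material

/-! ### Smoothness and transport of the iterated Lie derivatives -/

section Iterates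

variable {Ω : Set (ℝ × E3)}

lemma contDiffOn_lieD (hΩ : IsOpen Ω) {v : ℝ → E3 → E3} {f : ℝ → E3 → ℝ}
    (hv : ContDiffOn ℝ ∞ (fun p : ℝ × E3 => v p.1 p.2) Ω)
    (hf : ContDiffOn ℝ ∞ (fun p : ℝ × E3 => f p.1 p.2) Ω) :
    ContDiffOn ℝ ∞ (fun p : ℝ × E3 => lieD (v p.1) (f p.1) p.2) Ω := by
  have h : ContDiffOn ℝ ∞ (fun p : ℝ × E3 =>
      fderiv ℝ (fun p : ℝ × E3 => f p.1 p.2) p ((0 : ℝ), v p.1 p.2)) Ω :=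
    (hf.fderiv_of_isOpen hΩ (m := ∞) (by simp)).clm_apply (contDiffOn_const.prodMk hv)
  refine h.congr fun p hp => fderiv_slice ?_ _
  exact (hf.contDiffAt (hΩ.mem_nhds hp)).differentiableAt (by simp)

lemma contDiffOn_gradient (hΩ : IsOpen Ω) {f : ℝ → E3 → ℝ}
    (hf : ContDiffOn ℝ ∞ (fun p : ℝ × E3 => f p.1 p.2) Ω) :
    ContDiffOn ℝ ∞ (fun p : ℝ × E3 => gradient (f p.1) p.2) Ω := by
  rw [contDiffOn_euclidean]
  intro i
  simp only [gradient_coord]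
  exact contDiffOn_lieD hΩ (v := fun _ _ => EuclideanSpace.single i 1) contDiffOn_const hf

lemma contDiffOn_iterate_lieD (hΩ : IsOpen Ω) {v : ℝ → E3 → E3} {f : ℝ → E3 → ℝ}
    (hv : ContDiffOn ℝ ∞ (fun p : ℝ × E3 => v p.1 p.2) Ω)
    (hf : ContDiffOn ℝ ∞ (fun p : ℝ × E3 => f p.1 p.2) Ω) (n : ℕ) :
    ContDiffOn ℝ ∞ (fun p : ℝ × E3 => (lieD (v p.1))^[n] (f p.1) p.2) Ω := by
  induction n with
  | zero => exact hf
  | succ n ih =>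
    simp only [Function.iterate_succ_apply']
    exact contDiffOn_lieD hΩ (f := fun t => (lieD (v t))^[n] (f t)) hv ih

lemma materialD_iterate_lieD_eq_zero (hΩ : IsOpen Ω) {M : Set E3} (hM : IsOpen M) {t : ℝ}
    (hMΩ : ∀ x ∈ M, (t, x) ∈ Ω) {u v : ℝ → E3 → E3} {f : ℝ → E3 → ℝ}
    (hu : ContDiffOn ℝ ∞ (fun p : ℝ × E3 => u p.1 p.2) Ω)
    (hv : ContDiffOn ℝ ∞ (fun p : ℝ × E3 => v p.1 p.2) Ω)
    (hf : ContDiffOn ℝ ∞ (fun p : ℝ × E3 => f p.1 p.2) Ω)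
    (hvu : ∀ x ∈ M, materialD u v t x = fderiv ℝ (u t) x (v t x))
    (h0 : ∀ x ∈ M, materialD u f t x = 0) (n : ℕ) :
    ∀ x ∈ M, materialD u (fun t => (lieD (v t))^[n] (f t)) t x = 0 := by
  induction n with
  | zero => exact h0
  | succ n ih =>
    intro x hx
    have hnhds := hΩ.mem_nhds (hMΩ x hx)
    simp only [Function.iterate_succ_apply']
    exact materialD_lieD_eq_zero hM hx (f := fun t => (lieD (v t))^[n] (f t))
      (((contDiffOn_iterate_lieD hΩ hv hf n).contDiffAt hnhds).of_le (by norm_cast))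
      ((hu.contDiffAt hnhds).differentiableAt (by simp))
      ((hv.contDiffAt hnhds).differentiableAt (by simp)) (hvu x hx) ih

end Iterates

/-! ### The conserved helicities -/

lemma exists_common_domain {I : Set ℝ} {M : Set E3} {u B A₀ : ℝ → E3 → E3} {ρ ψ : ℝ → E3 → ℝ}
    (hu : SmoothUpToBoundary I M u) (hB : SmoothUpToBoundary I M B)
    (hA : SmoothUpToBoundary I M A₀) (hρ : SmoothUpToBoundary I M ρ)
    (hψ : SmoothUpToBoundary I M ψ) (hpos : ∀ t ∈ I, ∀ x ∈ closure M, 0 < ρ t x) :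
    ∃ Ω : Set (ℝ × E3), IsOpen Ω ∧ I ×ˢ closure M ⊆ Ω ∧
      ContDiffOn ℝ ∞ (fun p : ℝ × E3 => u p.1 p.2) Ω ∧
      ContDiffOn ℝ ∞ (fun p : ℝ × E3 => B p.1 p.2) Ω ∧
      ContDiffOn ℝ ∞ (fun p : ℝ × E3 => A₀ p.1 p.2) Ω ∧
      ContDiffOn ℝ ∞ (fun p : ℝ × E3 => ρ p.1 p.2) Ω ∧
      ContDiffOn ℝ ∞ (fun p : ℝ × E3 => ψ p.1 p.2) Ω ∧ ∀ p ∈ Ω, ρ p.1 p.2 ≠ 0 := by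
  obtain ⟨Ω₁, h₁, hI₁, hu⟩ := hu
  obtain ⟨Ω₂, h₂, hI₂, hB⟩ := hB
  obtain ⟨Ω₃, h₃, hI₃, hA⟩ := hA
  obtain ⟨Ω₄, h₄, hI₄, hρ⟩ := hρ
  obtain ⟨Ω₅, h₅, hI₅, hψ⟩ := hψ
  have h₆ : IsOpen (Ω₄ ∩ (fun p : ℝ × E3 => ρ p.1 p.2) ⁻¹' Ioi 0) :=
    hρ.continuousOn.isOpen_inter_preimage h₄ isOpen_Ioi
  refine ⟨Ω₁ ∩ Ω₂ ∩ Ω₃ ∩ Ω₅ ∩ (Ω₄ ∩ (fun p : ℝ × E3 => ρ p.1 p.2) ⁻¹' Ioi 0),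
    (((h₁.inter h₂).inter h₃).inter h₅).inter h₆, fun p hp =>
      ⟨⟨⟨⟨hI₁ hp, hI₂ hp⟩, hI₃ hp⟩, hI₅ hp⟩, hI₄ hp, hpos _ hp.1 _ hp.2⟩,
    hu.mono fun p hp => hp.1.1.1.1, hB.mono fun p hp => hp.1.1.1.2, hA.mono fun p hp => hp.1.1.2,
    hρ.mono fun p hp => hp.2.1, hψ.mono fun p hp => hp.1.2, fun p hp => ne_of_gt hp.2.2⟩

end MHD

theorem theorem2p1 (th : MHD.Thermodynamics)
    (I : Set ℝ) (hI : I.OrdConnected)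
    (M : Set MHD.E3) (hM : IsOpen M) (hbdry : MHD.HasAESmoothBoundary M)
    (u : ℝ → MHD.E3 → MHD.E3) (ρ η : ℝ → MHD.E3 → ℝ) (B : ℝ → MHD.E3 → MHD.E3)
    (hsol : MHD.IsSolution th I M u ρ η B)
    (A₀ : ℝ → MHD.E3 → MHD.E3) (hA₀ : MHD.IsMagneticPotential I M u B A₀)
    (ψ : ℝ → MHD.E3 → ℝ) (hψ : MHD.IsGaugeFunction I M u A₀ ψ)
    (A : ℝ → MHD.E3 → MHD.E3) (hA : A = MHD.gaugeTransform A₀ ψ) :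
    (∀ n : ℕ,
      (¬ Bornology.IsBounded M → MHD.IntegrableDensityAndFlux I M u ρ B A n) →
        (∀ t ∈ I, IntegrableOn (MHD.helicityDensity (ρ t) (B t) (A t) n) M) ∧
        ∀ s ∈ I, ∀ t ∈ I,
          MHD.helicity M (ρ s) (B s) (A s) n = MHD.helicity M (ρ t) (B t) (A t) n) ∧
    ∀ t ∈ I,
      MHD.helicity M (ρ t) (B t) (A t) 0 = ∫ x in M, inner ℝ (A t x) (MHD.curl (A t) x) := by
  obtain ⟨Ω, hΩ, hΩI, hu, hB, hA₀s, hρ, hψs, hρ0⟩ := MHD.exists_common_domain hsol.smooth_u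
    hsol.smooth_B hA₀.smooth hsol.smooth_ρ hψ.smooth hsol.ρ_pos
  have hMΩ : ∀ t ∈ I, ∀ x ∈ M, (t, x) ∈ Ω := fun t ht x hx => hΩI ⟨ht, subset_closure hx⟩
  have diff : ∀ {X : Type} [NormedAddCommGroup X] [NormedSpace ℝ X] {F : ℝ × MHD.E3 → X},
      ContDiffOn ℝ ∞ F Ω → ∀ t ∈ I, ∀ x ∈ M, DifferentiableAt ℝ F (t, x) :=
    fun hF t ht x hx =>
      (hF.contDiffAt (hΩ.mem_nhds (hMΩ t ht x hx))).differentiableAt (by simp)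
  have diff2 : ∀ {X : Type} [NormedAddCommGroup X] [NormedSpace ℝ X] {F : ℝ × MHD.E3 → X},
      ContDiffOn ℝ ∞ F Ω → ∀ t ∈ I, ∀ x ∈ M, ContDiffAt ℝ 2 F (t, x) :=
    fun hF t ht x hx =>
      (hF.contDiffAt (hΩ.mem_nhds (hMΩ t ht x hx))).of_le (by norm_cast)
  have hgr := MHD.contDiffOn_gradient hΩ hψs
  have hAs : ContDiffOn ℝ ∞ (fun p : ℝ × MHD.E3 => A p.1 p.2) Ω := by
    rw [hA]
    exact hA₀s.add hgr
  have hvs : ContDiffOn ℝ ∞ (fun p : ℝ × MHD.E3 => (ρ p.1 p.2)⁻¹ • B p.1 p.2) Ω :=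
    (hρ.inv hρ0).smul hB
  have hfs : ContDiffOn ℝ ∞
      (fun p : ℝ × MHD.E3 => (ρ p.1 p.2)⁻¹ * inner ℝ (B p.1 p.2) (A p.1 p.2)) Ω :=
    (hρ.inv hρ0).mul (hB.inner ℝ hAs)
  have hvu : ∀ t ∈ I, ∀ x ∈ M, MHD.materialD u (fun t y => (ρ t y)⁻¹ • B t y) t x =
      fderiv ℝ (u t) x ((ρ t x)⁻¹ • B t x) := fun t ht x hx => by
    refine MHD.materialD_specific_field (v := fun t y => (ρ t y)⁻¹ • B t y) hM hx
      (diff hu t ht x hx) (diff hρ t ht x hx)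
      (diff hB t ht x hx) (diff hvs t ht x hx) (diff2 hA₀s t ht x hx) (hρ0 _ (hMΩ t ht x hx)) ?_
      (hA₀.curl_eq t ht) (hsol.mass t ht x hx) (hsol.induction t ht x hx)
    filter_upwards [hΩ.mem_nhds (hMΩ t ht x hx)] with p hp
    rw [smul_inv_smul₀ (hρ0 p hp)]
  have hf0 : ∀ t ∈ I, ∀ x ∈ M,
      MHD.materialD u (fun t y => (ρ t y)⁻¹ * inner ℝ (B t y) (A t y)) t x = 0 :=
    fun t ht x hx => by
      have h := MHD.materialD_inner_eq_zero (diff hvs t ht x hx) (diff hAs t ht x hx)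
        (hvu t ht x hx) fun w => by
          rw [hA]
          exact MHD.inner_materialD_gaugeTransform hM hx (diff hu t ht x hx)
            (diff hA₀s t ht x hx) (diff2 hψs t ht x hx) (diff hgr t ht x hx) (diff hψs t ht)
            (hA₀.curl_eq t ht x hx) (hA₀.electric t ht x hx) (hψ.transport t ht) w
      simpa only [real_inner_smul_left] using h
  refine ⟨fun n hn => ?_, fun t ht => ?_⟩
  · have hFs := MHD.contDiffOn_iterate_lieD hΩ (v := fun t y => (ρ t y)⁻¹ • B t y)
      (f := fun t y => (ρ t y)⁻¹ * inner ℝ (B t y) (A t y)) hvs hfs n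
    have hF0 := fun t ht => MHD.materialD_iterate_lieD_eq_zero hΩ hM (hMΩ t ht) hu
      (v := fun t y => (ρ t y)⁻¹ • B t y)
      (f := fun t y => (ρ t y)⁻¹ * inner ℝ (B t y) (A t y)) hvs hfs (hvu t ht) (hf0 t ht) n
    have hγs : ContDiffOn ℝ ∞
        (fun p : ℝ × MHD.E3 => MHD.helicityDensity (ρ p.1) (B p.1) (A p.1) n p.2) Ω :=
      hρ.mul hFs
    have hint : MHD.IntegrableDensityAndFlux I M u ρ B A n := by
      by_cases hMb : Bornology.IsBounded M
      · exact MHD.integrable_of_isBounded (γ := fun t => MHD.helicityDensity (ρ t) (B t) (A t) n)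
          hΩI hI hMb hγs.continuousOn hu.continuousOn
      · exact hn hMb
    refine ⟨hint.1, fun s hs t ht => ?_⟩
    exact MHD.integral_eq_of_continuity_equation
      (γ := fun t => MHD.helicityDensity (ρ t) (B t) (A t) n) hI hM hbdry hΩ hΩI
      (hγs.of_le (by norm_cast)) (hu.of_le (by norm_cast)) hsol.tangent_u
      (fun t ht x hx => MHD.continuity_equation_mul (diff hu t ht x hx) (diff hρ t ht x hx)
        (diff hFs t ht x hx) (hsol.mass t ht x hx) (hF0 t ht x hx)) hint.1 hint.2 hs ht
  · refine setIntegral_congr_fun hM.measurableSet fun x hx => ?_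
    have hcurl : MHD.curl (A t) x = B t x := by
      rw [hA₀.curl_eq t ht x hx, hA]
      exact MHD.curl_add_gradient (MHD.differentiableAt_slice (diff hA₀s t ht x hx))
        (MHD.contDiffAt_slice (diff2 hψs t ht x hx))
    simp only [MHD.helicityDensity, Function.iterate_zero, id_eq]
    rw [hcurl, mul_inv_cancel_left₀ (hρ0 _ (hMΩ t ht x hx)), real_inner_comm]
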